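/- Fix a sleep rate $\lambda>0$ and a probability $p\in(0,1)$ to jump to the left. Activated Random Walks on $\mathbb Z$ are considered through their site-wise representation. A configuration is a map $\eta:\mathbb Z\to\mathbb N\cup\{\mathfrak s\}$, where $\eta(x)=k$ means that there are $k$ active particles at $x$ and $\eta(x)=\mathfrak s$ that there is exactly one particle at $x$, which is sleeping. Let $\tau=(\tau_{x,j})_{x\in\mathbb Z,\,j\ge 1}$ be an i.i.d. array of instructions, with law $\mathbb P$, each being "sleep" with probability $\lambda/(1+\lambda)$, "jump to $x-1$" with probability $p/(1+\lambda)$ and "jump to $x+1$" with probability $(1-p)/(1+\lambda)$. A site $x$ may be (legally) toppled when it hosts at least one active particle; toppling $x$ means applying the first unused instruction at $x$: a jump instruction moves one particle from $x$ to the neighbouring site, where it wakes up the sleeping particle if there is one, and a sleep instruction makes the particle at $x$ fall asleep if it is alone there and has no effect otherwise. For $n\ge 1$ let $V_n=\{1,\dots,n\}$. The driven-dissipative Markov chain on $\{0,\mathfrak s\}^{V_n}$ has the following transitions: add one active particle at a uniformly chosen site of $V_n$ and, with a fresh array of instructions, legally topple sites of $V_n$ until no active particle remains in $V_n$, particles being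 killed when they jump out of $V_n$. For $k\ge 1$ let $A_k$ be the random set of sites of $\mathbb Z$ that are visited at least once (that is, host a particle after some finite legal sequence of topplings) when the system evolves on $\mathbb Z$ from $k$ active particles at $0$ and no particle elsewhere. Then, for every $n\ge1$, the driven-dissipative chain on $V_n$ has a unique stationary distribution and, denoting by $S_n$ the number of sleeping particles in a configuration sampled from it, for every $k\ge 1$ and every $x\in V_n$, $$\mathbb P(x+A_k\subset V_n)\ \le\ \mathbb P(S_n\ge k).$$ -/

import Mathlib

open MeasureTheory

namespace ARW

/-- The state of a site, an element of `ℕ ∪ {𝔰}`: either `k` active particles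
(`active 0` is an empty site) or exactly one sleeping particle. -/
inductive SiteState where
  | active (k : ℕ) : SiteState
  | sleeping : SiteState

/-- Adding one active particle; it wakes up the sleeping particle, if there is one. -/
def SiteState.add : SiteState → SiteState
  | .active k => .active (k + 1)
  | .sleeping => .active 2

/-- Removing one active particle (only used on sites with an active particle). -/
def SiteState.remove : SiteState → SiteState
  | .active k => .active (k - 1)
  | .sleeping => .sleeping

/-- Effect of a sleep instruction: a lone active particle falls asleep,
otherwise nothing happens. -/
def SiteState.sleep : SiteState → SiteState
  | .active 1 => .sleeping
  | s => s

/-- A particle configuration on `ℤ`. -/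
abbrev Config := ℤ → SiteState

/-- The site `x` is unstable: it hosts at least one active particle. -/
def IsUnstable (η : Config) (x : ℤ) : Prop := ∃ k : ℕ, η x = .active (k + 1)

/-- The site `x` hosts at least one particle, active or sleeping. -/
def IsOccupied (η : Config) (x : ℤ) : Prop := η x ≠ .active 0

/-- The configuration `η + δ_x`: one active particle is added at `x`. -/
def addParticle (η : Config) (x : ℤ) : Config := Function.update η x (η x).add

/-- The configuration with one active particle less at `x`. -/
def removeParticle (η : Config) (x : ℤ) : Config := Function.update η x (η x).remove

/-- The configuration `k δ_0`: `k` active particles at the origin, nothing elsewhere. -/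
def pointSource (k : ℕ) : Config :=
  Function.update (fun _ => SiteState.active 0) 0 (SiteState.active k)

/-- Instructions: fall asleep, jump to the left neighbour, jump to the right neighbour. -/
inductive Instruction where
  | sleep : Instruction
  | left : Instruction
  | right : Instruction

instance : MeasurableSpace Instruction := ⊤

/-- Arrays of instructions. The entry `τ (x, j)` is the instruction number `j + 1` at `x`. -/
abbrev InstrArray := ℤ × ℕ → Instruction

/-- Applying an instruction at the site `x`. -/
def applyInstr (i : Instruction) (x : ℤ) (η : Config) : Config :=
  match i with
  | .sleep => Function.update η x (η x).sleep
  | .left => addParticle (removeParticle η x) (x - 1)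
  | .right => addParticle (removeParticle η x) (x + 1)

/-- A configuration together with an odometer, which counts the instructions
already used at each site. -/
structure State where
  config : Config
  odometer : ℤ → ℕ

/-- The state with configuration `η` and no instruction used. -/
def State.init (η : Config) : State := ⟨η, fun _ => 0⟩

/-- Toppling the site `x`: the next unused instruction at `x` is applied. -/
def topple (τ : InstrArray) (s : State) (x : ℤ) : State where
  config := applyInstr (τ (x, s.odometer x)) x s.config
  odometer := Function.update s.odometer x (s.odometer x + 1)

/-- The state obtained by toppling the sites of the list `α` in order. -/
def run (τ : InstrArray) (s : State) (α : List ℤ) : State := α.foldl (topple τ) s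

/-- The toppling sequence `α` is legal: each site is unstable when it is toppled. -/
def IsLegal (τ : InstrArray) : State → List ℤ → Prop
  | _, [] => True
  | s, x :: α => IsUnstable s.config x ∧ IsLegal τ (topple τ s x) α

/-- The set of sites visited during the evolution on `ℤ` started from `η`:
those which host a particle after some finite legal toppling sequence. -/
def visited (τ : InstrArray) (η : Config) : Set ℤ :=
  {y | ∃ α : List ℤ, IsLegal τ (State.init η) α ∧
    IsOccupied (run τ (State.init η) α).config y}

/-- The aggregate `A_k` of the point source `k δ_0`. -/
def aggregate (k : ℕ) (τ : InstrArray) : Set ℤ := visited τ (pointSource k)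

/-- The segment `V_n = {1, …, n}`. -/
noncomputable abbrev segment (n : ℕ) : Finset ℤ := Finset.Icc 1 (n : ℤ)

/-- Stable configurations on `V_n`, i.e. elements of `{0, 𝔰}^{V_n}`, encoded by the
set of sites which host a sleeping particle. Its cardinality is the number of particles. -/
abbrev StableConfig (n : ℕ) := Finset (segment n)

/-- The value at a site of `V_n` of a stable configuration. -/
noncomputable def StableConfig.value {n : ℕ} (A : StableConfig n) (y : segment n) : SiteState :=
  if y ∈ A then .sleeping else .active 0

/-- The configuration on `ℤ` equal to `A` on `V_n` and empty outside `V_n`. -/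
noncomputable def StableConfig.toConfig {n : ℕ} (A : StableConfig n) : Config :=
  fun y => if h : y ∈ segment n then A.value ⟨y, h⟩ else .active 0

/-- With the instructions `τ`, the stabilization of `η` in `V_n` ends in the stable
configuration `B`: some legal sequence of topplings of sites of `V_n` leads to a
configuration that is equal to `B` in `V_n`. Particles outside `V_n` are
never toppled, which amounts to killing them when they jump out. -/
def StabilizesTo {n : ℕ} (τ : InstrArray) (η : Config) (B : StableConfig n) : Prop :=
  ∃ α : List ℤ, (∀ y ∈ α, y ∈ segment n) ∧ IsLegal τ (State.init η) α ∧
    ∀ y : segment n, (run τ (State.init η) α).config y = B.value y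

/-- The weights of the instructions for the sleep rate `lam` and the probability `p`
to jump to the left. -/
noncomputable def instrWeight (lam p : ℝ) : Instruction → ℝ
  | .sleep => lam / (1 + lam)
  | .left => p / (1 + lam)
  | .right => (1 - p) / (1 + lam)

instance : Fintype Instruction where
  elems := ⟨↑[Instruction.sleep, Instruction.left, Instruction.right], by simp⟩
  complete := by intro i; cases i <;> simp

theorem sum_instrWeight {lam p : ℝ} (hlam : 0 < lam) (hp : p ∈ Set.Ioo (0 : ℝ) 1) :
    ∑ i, ENNReal.ofReal (instrWeight lam p i) = 1 := by
  have h1 : (0 : ℝ) < 1 + lam := by linarith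
  rw [← ENNReal.ofReal_sum_of_nonneg]
  · have : ∑ i, instrWeight lam p i
        = instrWeight lam p .sleep + (instrWeight lam p .left + (instrWeight lam p .right + 0)) :=
      rfl
    rw [this]
    simp only [instrWeight]
    rw [← ENNReal.ofReal_one]
    congr 1
    field_simp
    ring
  · intro i _
    have := hp.1
    have : 0 < 1 - p := by linarith [hp.2]
    cases i <;> simp only [instrWeight] <;> positivity

/-- The law of one instruction. -/
noncomputable def instrLaw (lam p : ℝ) (hlam : 0 < lam) (hp : p ∈ Set.Ioo (0 : ℝ) 1) :
    PMF Instruction :=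
  PMF.ofFintype (fun i => ENNReal.ofReal (instrWeight lam p i)) (sum_instrWeight hlam hp)

/-- The law of an array of independent and identically distributed instructions. -/
noncomputable def arrayLaw (lam p : ℝ) (hlam : 0 < lam) (hp : p ∈ Set.Ioo (0 : ℝ) 1) :
    Measure InstrArray :=
  Measure.infinitePi fun _ => (instrLaw lam p hlam hp).toMeasure

/-- Transition probabilities of the driven-dissipative Markov chain on `V_n`: an active
particle is added to `A` at a uniformly chosen site of `V_n`, and the
result is stabilized in `V_n` with a fresh array of instructions. -/
noncomputable def transition (lam p : ℝ) (hlam : 0 < lam) (hp : p ∈ Set.Ioo (0 : ℝ) 1)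
    {n : ℕ} (A B : StableConfig n) : ENNReal :=
  (∑ x : segment n, arrayLaw lam p hlam hp {τ | StabilizesTo τ (addParticle A.toConfig x) B})
    / (n : ENNReal)

/-- `π` is a stationary distribution of the driven-dissipative Markov chain on `V_n`. -/
def IsStationary (lam p : ℝ) (hlam : 0 < lam) (hp : p ∈ Set.Ioo (0 : ℝ) 1)
    {n : ℕ} (π : PMF (StableConfig n)) : Prop :=
  ∀ B : StableConfig n, ∑ A, π A * transition lam p hlam hp A B = π B

/-- The law of the number of sleeping particles in a random stable configuration with
distribution `π`. For `π` stationary, this is the law of `S_n`. -/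
noncomputable def sleepingCountLaw {n : ℕ} (π : PMF (StableConfig n)) : PMF ℕ :=
  π.map Finset.card

end ARW

/-! Fix `x` in `V_n` and stabilize `k` active particles at `x` inside `V_n`. If `x + A_k ⊂ V_n`, no
legal toppling sends a particle out, so all `k` survive (`arrayLaw_aggregate_le`). The left side is
thus at most the probability that this stabilization keeps at least `k` particles.

Conversely, adding `k` particles at `x` to a stationary configuration and stabilizing gives the
stationary law back: by the abelian property, adding at `x` commutes with the chain, hence sends `π`
to a stationary law, which is `π` by uniqueness (`IsStationary.sum_addParticle`). It remains to see
that the particles already present can only increase the number of survivors in law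
(`stabProb_atLeast_single_le`). Waking the sleeping ones lowers this number
(`stabProb_atLeast_wake_le`), and deleting the resulting active ones lowers it further
(`stabProb_atLeast_le_add_single`).

These comparisons use potential theory instead of couplings. The probability `stabProb T η` of
stabilizing in `T` is harmonic under every legal toppling (`stabProb_eq_sum`), and the minimum
principle `nonneg_of_superharmonic` reduces inequalities to stable configurations. It also gives
almost sure stabilization and `IsHarmonic.eq_sum`, from which particles may be added one at a time
(`stabProb_addParticle`). Uniqueness of `π` is Doeblin's argument: the empty configuration is
reachable in one step from everywhere. -/

namespace ARW

/-! ### Local rules and the abelian property of legal topplings -/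

/-- The number of particles, active or sleeping, at a site. -/
def SiteState.count : SiteState → ℕ
  | .active k => k
  | .sleeping => 1

/-- The effect of an instruction on the site where it is used. -/
def Instruction.own : Instruction → SiteState → SiteState
  | .sleep, s => s.sleep
  | .left, s => s.remove
  | .right, s => s.remove

/-- The site to which the particle is sent by an instruction used at `x`. -/
def Instruction.target : Instruction → ℤ → ℤ
  | .sleep, x => x
  | .left, x => x - 1
  | .right, x => x + 1

theorem applyInstr_apply (i : Instruction) (x : ℤ) (η : Config) (z : ℤ) :
    applyInstr i x η z =
      if z = x then i.own (η x) else if z = i.target x then (η z).add else η z := by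
  cases i <;> simp only [applyInstr, addParticle, removeParticle, Instruction.own,
    Instruction.target, Function.update_apply] <;> split_ifs <;> first | rfl | omega | simp_all

theorem addParticle_apply (η : Config) (x z : ℤ) :
    addParticle η x z = if z = x then (η z).add else η z := by
  simp only [addParticle, Function.update_apply]
  split_ifs with h
  · rw [h]
  · rfl

/-- This is the source of the abelian property. The only delicate case is a sleep instruction on a
lone particle: an arrival wakes it afterwards, or prevents it from falling asleep beforehand, and
both give two active particles. -/
theorem Instruction.own_add (i : Instruction) (k : ℕ) :
    i.own (SiteState.active (k + 1)).add = (i.own (.active (k + 1))).add := by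
  cases i
  · cases k <;> rfl
  · rfl
  · rfl

theorem applyInstr_comm {η : Config} {x y : ℤ} (hx : IsUnstable η x) (hy : IsUnstable η y)
    (hxy : x ≠ y) (i j : Instruction) :
    applyInstr j y (applyInstr i x η) = applyInstr i x (applyInstr j y η) := by
  obtain ⟨k, hk⟩ := hx
  obtain ⟨l, hl⟩ := hy
  funext z
  have hi := i.own_add k
  have hj := j.own_add l
  rw [← hk] at hi
  rw [← hl] at hj
  simp only [applyInstr_apply]
  grind

theorem applyInstr_addParticle {η : Config} {x : ℤ} (hx : IsUnstable η x) (i : Instruction)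
    (y : ℤ) : applyInstr i x (addParticle η y) = addParticle (applyInstr i x η) y := by
  obtain ⟨k, hk⟩ := hx
  have hi := i.own_add k
  rw [← hk] at hi
  funext z
  simp only [applyInstr_apply, addParticle_apply]
  grind

theorem SiteState.add_eq_active (s : SiteState) : ∃ k, s.add = .active (k + 1) := by
  cases s
  · exact ⟨_, rfl⟩
  · exact ⟨1, rfl⟩

theorem isUnstable_addParticle {η : Config} {x y : ℤ} (h : x = y ∨ IsUnstable η x) :
    IsUnstable (addParticle η y) x := by
  rw [IsUnstable, addParticle_apply]
  by_cases hxy : x = y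
  · simpa [hxy] using SiteState.add_eq_active _
  · rw [if_neg hxy]
    exact h.resolve_left hxy

theorem isUnstable_applyInstr_of_ne {η : Config} {x y : ℤ} (h : IsUnstable η x) (hxy : x ≠ y)
    (i : Instruction) : IsUnstable (applyInstr i y η) x := by
  rw [IsUnstable, applyInstr_apply, if_neg hxy]
  split_ifs
  · exact SiteState.add_eq_active _
  · exact h

theorem isUnstable_topple_of_ne {τ : InstrArray} {s : State} {x y : ℤ}
    (h : IsUnstable s.config x) (hxy : x ≠ y) : IsUnstable (topple τ s y).config x :=
  isUnstable_applyInstr_of_ne h hxy _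

theorem topple_comm {τ : InstrArray} {s : State} {x y : ℤ} (hx : IsUnstable s.config x)
    (hy : IsUnstable s.config y) (hxy : x ≠ y) :
    topple τ (topple τ s x) y = topple τ (topple τ s y) x := by
  simp only [topple, Function.update_of_ne hxy, Function.update_of_ne hxy.symm, State.mk.injEq]
  exact ⟨applyInstr_comm hx hy hxy _ _, Function.update_comm hxy _ _ _⟩

/-- In a legal sequence, the first toppling of an unstable site can be performed first. -/
theorem IsLegal.exists_cons {τ : InstrArray} {x : ℤ} {α : List ℤ} :
    ∀ {s : State}, IsLegal τ s α → IsUnstable s.config x → x ∈ α →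
      ∃ β : List ℤ, (∀ y ∈ β, y ∈ α) ∧ IsLegal τ (topple τ s x) β ∧
        run τ (topple τ s x) β = run τ s α := by
  induction α with
  | nil => intro s _ _ h; simp at h
  | cons y α ih =>
    intro s hα hx hmem
    by_cases hxy : x = y
    · subst hxy
      exact ⟨α, fun y hy => List.mem_cons_of_mem _ hy, hα.2, rfl⟩
    · obtain ⟨β, hβ, hleg, hrun⟩ := ih hα.2 (isUnstable_topple_of_ne hx hxy)
        (by simpa [hxy] using hmem)
      -- The induction hypothesis brings `x` to the position just after `y`; both sites are
      -- unstable, so the two topplings can be exchanged.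
      rw [← topple_comm hx hα.1 hxy] at hleg hrun
      refine ⟨y :: β, ?_, ⟨isUnstable_topple_of_ne hα.1 (Ne.symm hxy), hleg⟩, hrun⟩
      intro z hz
      rcases List.mem_cons.1 hz with rfl | hz
      · simp
      · exact List.mem_cons_of_mem _ (hβ z hz)

theorem isUnstable_run_of_notMem {τ : InstrArray} {x : ℤ} {α : List ℤ} :
    ∀ {s : State}, IsUnstable s.config x → x ∉ α → IsUnstable (run τ s α).config x := by
  induction α with
  | nil => intro s h _; exact h
  | cons y α ih =>
    intro s h hx
    simp only [List.mem_cons, not_or] at hx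
    exact ih (isUnstable_topple_of_ne h hx.1) hx.2

/-! ### Restarting the dynamics after one toppling -/

/-- The array obtained by removing the first `m x` instructions at each site `x`. -/
def shift (m : ℤ → ℕ) (τ : InstrArray) : InstrArray := fun a => τ (a.1, m a.1 + a.2)

theorem topple_shift (τ : InstrArray) (m : ℤ → ℕ) (s : State) (x : ℤ) :
    topple τ ⟨s.config, m + s.odometer⟩ x =
      ⟨(topple (shift m τ) s x).config, m + (topple (shift m τ) s x).odometer⟩ := by
  simp only [topple, shift, Pi.add_apply, State.mk.injEq, true_and]
  funext z
  by_cases h : z = x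
  · subst h; simp [add_assoc]
  · simp [h]

theorem isLegal_shift (τ : InstrArray) (m : ℤ → ℕ) (α : List ℤ) :
    ∀ s : State, IsLegal τ ⟨s.config, m + s.odometer⟩ α ↔ IsLegal (shift m τ) s α := by
  induction α with
  | nil => intro s; exact Iff.rfl
  | cons x α ih => intro s; simp only [IsLegal, topple_shift, ih]

theorem run_shift (τ : InstrArray) (m : ℤ → ℕ) (α : List ℤ) :
    ∀ s : State, (run τ ⟨s.config, m + s.odometer⟩ α).config = (run (shift m τ) s α).config := by
  induction α with
  | nil => intro s; rfl
  | cons x α ih => intro s; simpa only [run, List.foldl_cons, topple_shift] using ih _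

theorem topple_init (τ : InstrArray) (η : Config) (x : ℤ) :
    topple τ (State.init η) x =
      ⟨(State.init (applyInstr (τ (x, 0)) x η)).config,
        Pi.single x 1 + (State.init (applyInstr (τ (x, 0)) x η)).odometer⟩ := by
  simp only [topple, State.init, State.mk.injEq, true_and]
  funext z
  by_cases h : z = x
  · subst h; simp
  · simp [h]

theorem isLegal_init_cons (τ : InstrArray) (η : Config) (x : ℤ) (α : List ℤ) :
    IsLegal τ (State.init η) (x :: α) ↔ IsUnstable η x ∧
      IsLegal (shift (Pi.single x 1) τ) (State.init (applyInstr (τ (x, 0)) x η)) α := by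
  rw [← isLegal_shift, ← topple_init]
  rfl

theorem run_init_cons (τ : InstrArray) (η : Config) (x : ℤ) (α : List ℤ) :
    (run τ (State.init η) (x :: α)).config =
      (run (shift (Pi.single x 1) τ) (State.init (applyInstr (τ (x, 0)) x η)) α).config := by
  rw [← run_shift, ← topple_init]
  rfl

theorem StableConfig.not_isUnstable_of_eq {n : ℕ} {B : StableConfig n} {η : Config}
    {y : segment n} (h : η y = B.value y) : ¬ IsUnstable η y := by
  rintro ⟨k, hk⟩
  rw [hk, StableConfig.value] at h
  split_ifs at h
  simp at h

/-- Stabilization commutes with a legal toppling. -/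
theorem stabilizesTo_iff_of_isUnstable {n : ℕ} {τ : InstrArray} {η : Config}
    {B : StableConfig n} {x : ℤ} (hx : x ∈ segment n) (hu : IsUnstable η x) :
    StabilizesTo τ η B ↔
      StabilizesTo (shift (Pi.single x 1) τ) (applyInstr (τ (x, 0)) x η) B := by
  constructor
  · rintro ⟨α, hα, hleg, hrun⟩
    -- An unstable site remains unstable until it is toppled, whereas the final configuration is
    -- stable in `V_n`.
    have hmem : x ∈ α := by
      by_contra h
      exact StableConfig.not_isUnstable_of_eq (hrun ⟨x, hx⟩)
        (isUnstable_run_of_notMem (s := State.init η) hu h)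
    obtain ⟨β, hβ, hleg', hrun'⟩ := hleg.exists_cons hu hmem
    have h1 := (isLegal_init_cons τ η x β).1 ⟨hu, hleg'⟩
    refine ⟨β, fun y hy => hα y (hβ y hy), h1.2, fun y => ?_⟩
    rw [← run_init_cons, ← hrun y, ← hrun']
    rfl
  · rintro ⟨β, hβ, hleg, hrun⟩
    refine ⟨x :: β, ?_, (isLegal_init_cons τ η x β).2 ⟨hu, hleg⟩, fun y => ?_⟩
    · intro y hy
      rcases List.mem_cons.1 hy with rfl | hy
      · exact hx
      · exact hβ y hy
    · rw [run_init_cons, hrun y]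

theorem IsLegal.eq_nil_of_stable {τ : InstrArray} {s : State} {α : List ℤ} {V : Set ℤ}
    (hα : IsLegal τ s α) (hV : ∀ y ∈ α, y ∈ V) (hs : ∀ y ∈ V, ¬ IsUnstable s.config y) :
    α = [] := by
  cases α with
  | nil => rfl
  | cons y α => exact absurd hα.1 (hs y (hV y (by simp)))

theorem stabilizesTo_iff_of_stable {n : ℕ} {τ : InstrArray} {η : Config} {B : StableConfig n}
    (hη : ∀ y ∈ segment n, ¬ IsUnstable η y) :
    StabilizesTo τ η B ↔ ∀ y : segment n, η y = B.value y := by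
  constructor
  · rintro ⟨α, hα, hleg, hrun⟩
    obtain rfl := hleg.eq_nil_of_stable (V := segment n) hα hη
    exact hrun
  · intro h
    exact ⟨[], by simp, trivial, h⟩

/-- Legal sequences of topplings of sites of `V` depend only on the configuration on `V`. -/
theorem IsLegal.congr {τ : InstrArray} {V : Set ℤ} {α : List ℤ} :
    ∀ {s t : State}, IsLegal τ s α → (∀ y ∈ α, y ∈ V) → (∀ y ∈ V, s.config y = t.config y) →
      s.odometer = t.odometer →
      IsLegal τ t α ∧ ∀ y ∈ V, (run τ s α).config y = (run τ t α).config y := by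
  induction α with
  | nil => intro s t _ _ h _; exact ⟨trivial, h⟩
  | cons x α ih =>
    intro s t hα hV h ho
    have hx : x ∈ V := hV x (by simp)
    have := ih (t := topple τ t x) hα.2 (fun y hy => hV y (by simp [hy])) ?_ ?_
    · refine ⟨⟨?_, this.1⟩, this.2⟩
      have := hα.1
      rwa [IsUnstable, h x hx] at this
    · intro y hy
      simp only [topple, applyInstr_apply, ho, h y hy, h x hx]
    · simp only [topple, ho]

theorem stabilizesTo_congr {n : ℕ} {τ : InstrArray} {η ζ : Config} {B : StableConfig n}
    (h : ∀ y ∈ segment n, η y = ζ y) : StabilizesTo τ η B ↔ StabilizesTo τ ζ B := by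
  have key : ∀ {η ζ : Config}, (∀ y ∈ segment n, η y = ζ y) →
      StabilizesTo τ η B → StabilizesTo τ ζ B := by
    rintro η ζ h ⟨α, hα, hleg, hrun⟩
    have := hleg.congr (V := segment n) (t := State.init ζ) hα h rfl
    exact ⟨α, hα, this.1, fun y => by rw [← hrun y, this.2 y y.2]⟩
  exact ⟨key h, key fun y hy => (h y hy).symm⟩

/-! ### Independence of the first instruction, and measurability -/

theorem infinitePi_eval_inter_comp {ι X : Type*} [MeasurableSpace X] (μ : Measure X)
    [IsProbabilityMeasure μ] {e : ι → ι} (he : e.Injective) {a : ι} (ha : ∀ j, e j ≠ a)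
    {u : Set X} (hu : MeasurableSet u) {S : Set (ι → X)} (hS : MeasurableSet S) :
    Measure.infinitePi (fun _ : ι => μ) ({τ | τ a ∈ u} ∩ {τ | τ ∘ e ∈ S}) =
      μ u * Measure.infinitePi (fun _ : ι => μ) S := by
  classical
  have hmeas : Measurable fun τ : ι → X => τ ∘ e :=
    measurable_pi_lambda _ fun j => measurable_pi_apply (e j)
  have hA : MeasurableSet {τ : ι → X | τ a ∈ u} := measurable_pi_apply a hu
  have hAu : Measure.infinitePi (fun _ : ι => μ) {τ : ι → X | τ a ∈ u} = μ u :=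
    (measurePreserving_eval_infinitePi (fun _ : ι => μ) a).measure_preimage hu.nullMeasurableSet
  by_cases h0 : μ u = 0
  · rw [h0, zero_mul]
    exact measure_mono_null Set.inter_subset_left (hAu.trans h0)
  -- Conditionally on `τ a ∈ u`, the relabelled array `τ ∘ e` is still i.i.d. with law `μ`; product
  -- measures are identified by their values on finite boxes.
  have hν : (μ u)⁻¹ • ((Measure.infinitePi fun _ : ι => μ).restrict
      {τ : ι → X | τ a ∈ u}).map (fun τ => τ ∘ e) = Measure.infinitePi fun _ : ι => μ := by
    apply Measure.eq_infinitePi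
    intro s t ht
    have hst : MeasurableSet ((s : Set ι).pi t) :=
      MeasurableSet.pi s.countable_toSet fun i _ => ht i
    rw [Measure.smul_apply, Measure.map_apply hmeas hst, Measure.restrict_apply (hmeas hst)]
    have : Nonempty ι := ⟨a⟩
    let t' : ι → Set X := fun b => if b = a then u else t (Function.invFun e b)
    have ht' : ∀ b, MeasurableSet (t' b) := by
      intro b
      by_cases hb : b = a
      · simpa [t', hb] using hu
      · simpa [t', hb] using ht _
    have hte : ∀ j, t' (e j) = t j := by
      intro j
      simp only [t', if_neg (ha j)]
      rw [Function.leftInverse_invFun he j]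
    have hta : t' a = u := by simp [t']
    have hset : (fun τ : ι → X => τ ∘ e) ⁻¹' (s : Set ι).pi t ∩ {τ | τ a ∈ u} =
        Set.pi (insert a (s.image e) : Finset ι) t' := by
      ext τ
      simp only [Set.mem_inter_iff, Set.mem_preimage, Set.mem_pi, Finset.mem_coe,
        Function.comp_apply, Set.mem_ofPred_eq, Finset.mem_insert, Finset.mem_image,
        forall_eq_or_imp, forall_exists_index, and_imp, forall_apply_eq_imp_iff₂, hte, hta]
      exact and_comm
    have hmem : a ∉ s.image e := by simp [ha]
    rw [hset, Measure.infinitePi_pi _ fun i _ => ht' i, Finset.prod_insert hmem,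
      Finset.prod_image he.injOn, hta, smul_eq_mul, ← mul_assoc,
      ENNReal.inv_mul_cancel h0 (measure_ne_top μ u), one_mul]
    simp only [hte]
  conv_rhs => rw [← hν]
  rw [Measure.smul_apply, Measure.map_apply hmeas hS, Measure.restrict_apply (hmeas hS),
    smul_eq_mul, ← mul_assoc, ENNReal.mul_inv_cancel h0 (measure_ne_top μ u), one_mul,
    Set.inter_comm]
  rfl

theorem measurableSet_instruction (u : Set Instruction) : MeasurableSet u :=
  MeasurableSpace.measurableSet_top

/-- For a fixed sequence only finitely many instructions matter; the event is split according to the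
first of them. -/
theorem measurableSet_isLegal_and_run (α : List ℤ) (Q : State → Prop) :
    ∀ s : State, MeasurableSet {τ : InstrArray | IsLegal τ s α ∧ Q (run τ s α)} := by
  induction α with
  | nil => 
    intro s
    simpa only [IsLegal, true_and, run, List.foldl_nil] using MeasurableSet.const (Q s)
  | cons x α ih =>
    intro s
    have : {τ : InstrArray | IsLegal τ s (x :: α) ∧ Q (run τ s (x :: α))} =
        ⋃ i : Instruction, {τ : InstrArray | τ (x, s.odometer x) = i} ∩
          ({_τ : InstrArray | IsUnstable s.config x} ∩
            {τ | IsLegal τ ⟨applyInstr i x s.config,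
                Function.update s.odometer x (s.odometer x + 1)⟩ α ∧
              Q (run τ ⟨applyInstr i x s.config,
                Function.update s.odometer x (s.odometer x + 1)⟩ α)}) := by
      ext τ
      simp only [Set.mem_ofPred_eq, Set.mem_iUnion, Set.mem_inter_iff, exists_eq_left', IsLegal,
        and_assoc]
      rfl
    rw [this]
    refine MeasurableSet.iUnion fun i => MeasurableSet.inter ?_
      ((MeasurableSet.const _).inter (ih _))
    have : Measurable fun τ : InstrArray => τ (x, s.odometer x) := measurable_pi_apply _
    exact this (measurableSet_instruction {i})

theorem measurableSet_stabilizesTo {n : ℕ} (η : Config) (T : Set (StableConfig n)) :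
    MeasurableSet {τ : InstrArray | ∃ B ∈ T, StabilizesTo τ η B} := by
  have : {τ : InstrArray | ∃ B ∈ T, StabilizesTo τ η B} =
      ⋃ (B : StableConfig n) (_ : B ∈ T) (α : List ℤ) (_ : ∀ y ∈ α, y ∈ segment n),
        {τ : InstrArray | IsLegal τ (State.init η) α ∧
          (fun s : State => ∀ y : segment n, s.config y = B.value y)
            (run τ (State.init η) α)} := by
    ext τ
    simp only [StabilizesTo, Set.mem_ofPred_eq, Set.mem_iUnion, exists_prop]
  rw [this]
  exact MeasurableSet.iUnion fun B => MeasurableSet.iUnion fun _ => MeasurableSet.iUnion fun α =>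
    MeasurableSet.iUnion fun _ => measurableSet_isLegal_and_run α
      (fun s : State => ∀ y : segment n, s.config y = B.value y) (State.init η)

/-! ### Stabilization probabilities and their harmonicity -/

theorem sum_instruction {M : Type*} [AddCommMonoid M] (f : Instruction → M) :
    ∑ i, f i = f .sleep + (f .left + f .right) := by
  have : ∑ i, f i = f .sleep + (f .left + (f .right + 0)) := rfl
  rw [this, add_zero]

theorem instrWeight_pos {lam p : ℝ} (hlam : 0 < lam) (hp : p ∈ Set.Ioo (0 : ℝ) 1)
    (i : Instruction) : 0 < instrWeight lam p i := by
  have := hp.1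
  have : 0 < 1 - p := by linarith [hp.2]
  cases i <;> simp only [instrWeight] <;> positivity

theorem sum_instrWeight_real {lam : ℝ} (p : ℝ) (hlam : 0 < lam) :
    ∑ i, instrWeight lam p i = 1 := by
  have : (1 : ℝ) + lam ≠ 0 := by positivity
  rw [sum_instruction]
  simp only [instrWeight]
  field_simp
  ring

theorem instrLaw_toMeasure_singleton {lam p : ℝ} (hlam : 0 < lam) (hp : p ∈ Set.Ioo (0 : ℝ) 1)
    (i : Instruction) :
    (instrLaw lam p hlam hp).toMeasure {i} = ENNReal.ofReal (instrWeight lam p i) := by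
  rw [PMF.toMeasure_apply_singleton _ _ (measurableSet_instruction _)]
  rfl

instance {lam p : ℝ} (hlam : 0 < lam) (hp : p ∈ Set.Ioo (0 : ℝ) 1) :
    IsProbabilityMeasure (arrayLaw lam p hlam hp) := by
  unfold arrayLaw
  infer_instance

/-- The probability that the stabilization of `η` in `V_n` ends in a configuration of `T`. -/
noncomputable def stabProb (lam p : ℝ) (hlam : 0 < lam) (hp : p ∈ Set.Ioo (0 : ℝ) 1) {n : ℕ}
    (T : Set (StableConfig n)) (η : Config) : ℝ :=
  (arrayLaw lam p hlam hp).real {τ | ∃ B ∈ T, StabilizesTo τ η B}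

section

variable {lam p : ℝ} {hlam : 0 < lam} {hp : p ∈ Set.Ioo (0 : ℝ) 1} {n : ℕ}

theorem stabProb_nonneg (T : Set (StableConfig n)) (η : Config) :
    0 ≤ stabProb lam p hlam hp T η := measureReal_nonneg

theorem stabProb_le_one (T : Set (StableConfig n)) (η : Config) :
    stabProb lam p hlam hp T η ≤ 1 := measureReal_le_one

theorem stabProb_congr (T : Set (StableConfig n)) {η ζ : Config}
    (h : ∀ y ∈ segment n, η y = ζ y) :
    stabProb lam p hlam hp T η = stabProb lam p hlam hp T ζ := by
  simp only [stabProb, stabilizesTo_congr h]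

/-- The stabilization probabilities are harmonic with respect to legal topplings. -/
theorem stabProb_eq_sum (T : Set (StableConfig n)) {η : Config} {x : ℤ} (hx : x ∈ segment n)
    (hu : IsUnstable η x) :
    stabProb lam p hlam hp T η =
      ∑ i, instrWeight lam p i * stabProb lam p hlam hp T (applyInstr i x η) := by
  -- Precomposition with `e` is `shift (Pi.single x 1)`. Its range avoids `(x, 0)`, so the shifted
  -- array is independent of the instruction just used.
  let e : ℤ × ℕ → ℤ × ℕ := fun a => (a.1, (Pi.single x 1 : ℤ → ℕ) a.1 + a.2)
  have he : e.Injective := by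
    rintro ⟨a, b⟩ ⟨c, d⟩ h
    simp only [e, Prod.mk.injEq] at h
    obtain ⟨rfl, h⟩ := h
    simpa using h
  have ha : ∀ j, e j ≠ (x, 0) := by
    rintro ⟨a, b⟩ h
    simp only [e, Prod.mk.injEq] at h
    obtain ⟨rfl, h⟩ := h
    simp at h
  let S : Instruction → Set InstrArray :=
    fun i => {τ | ∃ B ∈ T, StabilizesTo τ (applyInstr i x η) B}
  have hS : ∀ i, MeasurableSet (S i) := fun i => measurableSet_stabilizesTo _ T
  let R : Instruction → Set InstrArray := fun i => {τ | τ (x, 0) ∈ ({i} : Set Instruction)} ∩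
    {τ | τ ∘ e ∈ S i}
  have hset : {τ | ∃ B ∈ T, StabilizesTo τ η B} = ⋃ i, R i := by
    ext τ
    simp only [Set.mem_ofPred_eq, stabilizesTo_iff_of_isUnstable hx hu, Set.mem_iUnion, R, S,
      Set.mem_inter_iff, Set.mem_singleton_iff, exists_eq_left']
    rfl
  have hR : ∀ i, MeasurableSet (R i) := fun i =>
    (measurable_pi_apply (x, 0) (measurableSet_instruction {i})).inter
      ((measurable_pi_lambda _ fun j => measurable_pi_apply (e j)) (hS i))
  have hdisj : Pairwise (Function.onFun Disjoint R) := by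
    intro i j hij
    refine Set.disjoint_left.2 fun τ hi hj => hij ?_
    exact hi.1.symm.trans hj.1
  rw [stabProb, hset, measureReal_def, measure_iUnion hdisj hR, tsum_fintype,
    ENNReal.toReal_sum fun i _ => measure_ne_top _ _]
  refine Finset.sum_congr rfl fun i _ => ?_
  have := infinitePi_eval_inter_comp (instrLaw lam p hlam hp).toMeasure he ha
    (measurableSet_instruction {i}) (hS i)
  rw [arrayLaw, this, ENNReal.toReal_mul, instrLaw_toMeasure_singleton,
    ENNReal.toReal_ofReal (instrWeight_pos hlam hp i).le]
  rfl

/-- The stable configuration which has the same occupied sites as `η` in `V_n`. -/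
noncomputable def stableOf (n : ℕ) (η : Config) : StableConfig n :=
  open Classical in Finset.univ.filter fun y : segment n => IsOccupied η y

theorem eq_value_iff_of_stable {η : Config} (hη : ∀ y ∈ segment n, ¬ IsUnstable η y)
    (B : StableConfig n) : (∀ y : segment n, η y = B.value y) ↔ B = stableOf n η := by
  classical
  have key : ∀ y : segment n, η y = B.value y ↔ (y ∈ B ↔ y ∈ stableOf n η) := by
    intro y
    have h := hη y y.2
    rw [stableOf, Finset.mem_filter, StableConfig.value, IsOccupied]
    simp only [Finset.mem_univ, true_and]
    rcases hs : η y with (_ | k) | _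
    · by_cases hy : y ∈ B <;> simp [hy]
    · exact absurd ⟨k, hs⟩ h
    · by_cases hy : y ∈ B <;> simp [hy]
  simp only [key, Finset.ext_iff]

theorem stabProb_of_stable (T : Set (StableConfig n)) {η : Config}
    (hη : ∀ y ∈ segment n, ¬ IsUnstable η y) :
    stabProb lam p hlam hp T η = T.indicator 1 (stableOf n η) := by
  simp only [stabProb, stabilizesTo_iff_of_stable hη, eq_value_iff_of_stable hη,
    exists_eq_right]
  by_cases h : stableOf n η ∈ T <;> simp [h]

end

/-! ### The minimum principle -/

theorem count_applyInstr {η : Config} {z : ℤ} (hz : IsUnstable η z) (i : Instruction) (y : ℤ) :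
    ((applyInstr i z η y).count : ℝ) =
      (η y).count + (if y = i.target z then 1 else 0) - (if y = z then 1 else 0) := by
  obtain ⟨k, hk⟩ := hz
  have hadd : ∀ s : SiteState, (s.add.count : ℝ) = s.count + 1 := by
    rintro (k | _)
    · simp [SiteState.add, SiteState.count]
    · simp [SiteState.add, SiteState.count]
      norm_num
  rw [applyInstr_apply]
  by_cases h1 : y = z
  · subst h1
    cases i
    · cases k <;> simp [hk, Instruction.own, Instruction.target, SiteState.sleep, SiteState.count]
    · have : y ≠ y - 1 := by omega
      simp [hk, Instruction.own, Instruction.target, SiteState.remove, SiteState.count, this]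
    · simp [hk, Instruction.own, Instruction.target, SiteState.remove, SiteState.count]
  · rw [if_neg h1, if_neg h1]
    split_ifs
    · rw [hadd, sub_zero]
    · simp

/-- Superharmonic functions that are nonnegative on stable configurations are nonnegative.
Superharmonicity is only required where the function is negative, at one unstable site. -/
theorem nonneg_of_superharmonic {lam p : ℝ} (hlam : 0 < lam) (hp : p ∈ Set.Ioo (0 : ℝ) 1) {n : ℕ}
    {g : Config → ℝ} {M : ℝ} (hM : 0 ≤ M) (hg : ∀ η, -M ≤ g η)
    (hstep : ∀ η, g η < 0 → ∃ z ∈ segment n, IsUnstable η z ∧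
      ∑ i, instrWeight lam p i * g (applyInstr i z η) ≤ g η) (η : Config) : 0 ≤ g η := by
  have hp1 : 0 < 1 - p := by linarith [hp.2]
  have hl1 : 0 < 1 + lam := by linarith
  -- With `(1 - p) * r = 2`, the mean of `r ^ z` increases by at least `r ^ z / (1 + lam)` at each
  -- toppling of `z`, whatever the bias `p`.
  set r : ℝ := 2 / (1 - p) with hr
  have hr1 : 1 ≤ r := by
    rw [hr, le_div_iff₀ hp1]
    linarith [hp.1]
  have hr0 : 0 < r := by linarith
  let u : ℤ → ℝ := fun z => r ^ ((n : ℤ) + 1) - r ^ z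
  have hu : ∀ z ≤ (n : ℤ) + 1, 0 ≤ u z := fun z hz =>
    sub_nonneg.2 (zpow_le_zpow_right₀ hr1 hz)
  -- A Lyapunov function: each legal toppling lowers its mean by at least `1 / (1 + lam)`, so `(1 +
  -- lam) * E` bounds the expected number of topplings. As `u ≥ 0` up to `n + 1`, particles that
  -- leave `V_n` only help.
  let E : Config → ℝ := fun η => ∑ z ∈ segment n, ((η z).count : ℝ) * u z
  have hE0 : ∀ η, 0 ≤ E η := fun η => Finset.sum_nonneg fun z hz =>
    mul_nonneg (Nat.cast_nonneg _) (hu z (by have := Finset.mem_Icc.1 hz; omega))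
  have hE : ∀ η, ∀ z ∈ segment n, IsUnstable η z →
      ∑ i, instrWeight lam p i * E (applyInstr i z η) ≤ E η - 1 / (1 + lam) := by
    intro η z hz hun
    have hzn := Finset.mem_Icc.1 hz
    have h1 : ∀ i : Instruction, E (applyInstr i z η) ≤ E η + u (i.target z) - u z := by
      intro i
      have : E (applyInstr i z η) =
          E η + (if i.target z ∈ segment n then u (i.target z) else 0) - u z := by
        simp only [E, count_applyInstr hun, sub_mul, add_mul, Finset.sum_sub_distrib,
          Finset.sum_add_distrib, ite_mul, one_mul, zero_mul, Finset.sum_ite_eq',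
          if_pos hz]
      rw [this]
      have : 0 ≤ u (i.target z) := hu _ (by cases i <;> simp only [Instruction.target] <;> omega)
      split_ifs <;> linarith
    have h2 : ∑ i, instrWeight lam p i * E (applyInstr i z η) ≤
        ∑ i, instrWeight lam p i * (E η + u (i.target z) - u z) :=
      Finset.sum_le_sum fun i _ => mul_le_mul_of_nonneg_left (h1 i) (instrWeight_pos hlam hp i).le
    refine h2.trans ?_
    have h3 : ∑ i, instrWeight lam p i * (E η + u (i.target z) - u z) =
        E η - (r ^ z * (p * r⁻¹ + (1 - p) * r - 1)) / (1 + lam) := by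
      rw [sum_instruction]
      simp only [instrWeight, Instruction.target, u, zpow_sub_one₀ hr0.ne', zpow_add_one₀ hr0.ne']
      field_simp
      ring
    rw [h3]
    have h4 : (1 - p) * r = 2 := by rw [hr]; field_simp
    have h5 : 1 ≤ r ^ z := one_le_zpow₀ hr1 (by omega)
    have h6 : 0 ≤ p * r⁻¹ := mul_nonneg hp.1.le (inv_nonneg.2 hr0.le)
    gcongr
    nlinarith
  -- A form of Markov's inequality: `-g η` is at most `M` times the probability that more than `N`
  -- topplings are needed. Letting `N` tend to infinity concludes.
  have key : ∀ (N : ℕ) (η : Config), -(M * (1 + lam) * E η) ≤ N * g η := by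
    intro N
    induction N with
    | zero =>
      intro η
      have := hE0 η
      simp only [Nat.cast_zero, zero_mul, Left.neg_nonpos_iff]
      positivity
    | succ N ih =>
      intro η
      have hEη := hE0 η
      rcases le_or_gt 0 (g η) with h | h
      · have : 0 ≤ M * (1 + lam) * E η := by positivity
        have : 0 ≤ ((N + 1 : ℕ) : ℝ) * g η := by positivity
        linarith
      · obtain ⟨z, hz, hun, hsup⟩ := hstep η h
        have h1 : ∑ i, instrWeight lam p i * -(M * (1 + lam) * E (applyInstr i z η)) ≤
            ∑ i, instrWeight lam p i * (N * g (applyInstr i z η)) :=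
          Finset.sum_le_sum fun i _ =>
            mul_le_mul_of_nonneg_left (ih _) (instrWeight_pos hlam hp i).le
        have h2 : ∑ i, instrWeight lam p i * -(M * (1 + lam) * E (applyInstr i z η)) =
            -(M * (1 + lam) * ∑ i, instrWeight lam p i * E (applyInstr i z η)) := by
          rw [Finset.mul_sum, ← Finset.sum_neg_distrib]
          exact Finset.sum_congr rfl fun i _ => by ring
        have h3 : ∑ i, instrWeight lam p i * (N * g (applyInstr i z η)) =
            N * ∑ i, instrWeight lam p i * g (applyInstr i z η) := by
          rw [Finset.mul_sum]
          exact Finset.sum_congr rfl fun i _ => by ring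
        have h4 : M * (1 + lam) * ∑ i, instrWeight lam p i * E (applyInstr i z η) ≤
            M * (1 + lam) * (E η - 1 / (1 + lam)) :=
          mul_le_mul_of_nonneg_left (hE η z hz hun) (by positivity)
        have h5 : M * (1 + lam) * (E η - 1 / (1 + lam)) = M * (1 + lam) * E η - M := by
          field_simp
        have h6 : (N : ℝ) * ∑ i, instrWeight lam p i * g (applyInstr i z η) ≤ N * g η :=
          mul_le_mul_of_nonneg_left hsup (Nat.cast_nonneg N)
        have h7 := hg η
        push_cast
        linarith
  by_contra! hneg
  obtain ⟨N, hN⟩ := exists_nat_gt (M * (1 + lam) * E η / -g η)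
  rw [div_lt_iff₀ (by linarith)] at hN
  linarith [key N η]

section

variable {lam p : ℝ} {hlam : 0 < lam} {hp : p ∈ Set.Ioo (0 : ℝ) 1} {n : ℕ}

/-! ### Emptying the segment with positive probability -/

theorem stabProb_pos_of_applyInstr {T : Set (StableConfig n)} {η : Config} {x : ℤ}
    (hx : x ∈ segment n) (hu : IsUnstable η x) (i : Instruction)
    (h : 0 < stabProb lam p hlam hp T (applyInstr i x η)) : 0 < stabProb lam p hlam hp T η := by
  rw [stabProb_eq_sum T hx hu]
  refine Finset.sum_pos' (fun j _ => ?_) ⟨i, Finset.mem_univ i, ?_⟩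
  · exact mul_nonneg (instrWeight_pos hlam hp j).le (stabProb_nonneg _ _)
  · exact mul_pos (instrWeight_pos hlam hp i) h

/-- Sweeping to the right: all particles at `y` jump right, waking any sleeper at `y + 1`, so the
empty region grows until everything has left through `n + 1`. Here `d` is the distance from `y` to
`n + 1`. -/
theorem stabProb_empty_pos_of_empty_left (d : ℕ) : ∀ (η : Config) (y : ℤ), y + d = n + 1 → 1 ≤ y →
    (∀ z ∈ segment n, z < y → η z = .active 0) → (y ≤ n → IsUnstable η y) →
    0 < stabProb lam p hlam hp ({∅} : Set (StableConfig n)) η := by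
  induction d with
  | zero =>
    intro η y hy _ hemp _
    have h0 : ∀ z ∈ segment n, η z = .active 0 := fun z hz =>
      hemp z hz (by have := Finset.mem_Icc.1 hz; push_cast at hy; omega)
    rw [stabProb_of_stable]
    · have : stableOf n η = ∅ := by
        classical
        rw [stableOf, Finset.filter_eq_empty_iff]
        intro z _ hz
        exact hz (h0 z z.2)
      simp [this]
    · rintro z hz ⟨k, hk⟩
      simp [h0 z hz] at hk
  | succ d ih =>
    intro η y hy hy1 hemp hun
    push_cast at hy
    obtain ⟨k, hk⟩ := hun (by omega)
    have hmem : y ∈ segment n := Finset.mem_Icc.2 ⟨hy1, by omega⟩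
    induction k generalizing η with
    | zero =>
      refine stabProb_pos_of_applyInstr hmem ⟨0, hk⟩ .right
        (ih _ (y + 1) (by omega) (by omega) ?_ ?_)
      · intro z hz hzy
        rw [applyInstr_apply]
        by_cases h : z = y
        · simp [h, hk, Instruction.own, SiteState.remove]
        · rw [if_neg h, if_neg (by simp only [Instruction.target]; omega)]
          exact hemp z hz (by omega)
      · intro _
        rw [IsUnstable, applyInstr_apply, if_neg (by omega),
          if_pos (by simp only [Instruction.target])]
        exact SiteState.add_eq_active _
    | succ k ihk =>
      refine stabProb_pos_of_applyInstr hmem ⟨k + 1, hk⟩ .right ?_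
      have h1 : applyInstr .right y η y = .active (k + 1) := by
        simp [applyInstr_apply, hk, Instruction.own, SiteState.remove]
      refine ihk _ ?_ (fun _ => ⟨k, h1⟩) h1
      intro z hz hzy
      rw [applyInstr_apply, if_neg (by omega), if_neg (by simp only [Instruction.target]; omega)]
      exact hemp z hz hzy

/-- One active particle is first brought to site `1` by left jumps, where the sweep starts. -/
theorem stabProb_empty_pos_of_nat (m : ℕ) : ∀ η : Config, 1 + (m : ℤ) ≤ n →
    IsUnstable η (1 + m) → 0 < stabProb lam p hlam hp ({∅} : Set (StableConfig n)) η := by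
  induction m with
  | zero =>
    intro η _ hu
    simp only [Nat.cast_zero, add_zero] at hu
    refine stabProb_empty_pos_of_empty_left n η 1 (by omega) le_rfl ?_ fun _ => hu
    intro z hz hz1
    have := Finset.mem_Icc.1 hz
    omega
  | succ m ih =>
    intro η hm hu
    push_cast at hm hu
    refine stabProb_pos_of_applyInstr (Finset.mem_Icc.2 ⟨by omega, by omega⟩) hu .left
      (ih _ (by omega) ?_)
    rw [IsUnstable, applyInstr_apply, if_neg (by omega),
      if_pos (by simp only [Instruction.target]; omega)]
    exact SiteState.add_eq_active _

/-- An unstable configuration empties with positive probability. -/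
theorem stabProb_empty_pos {η : Config} {x : ℤ} (hx : x ∈ segment n) (hu : IsUnstable η x) :
    0 < stabProb lam p hlam hp ({∅} : Set (StableConfig n)) η := by
  have := Finset.mem_Icc.1 hx
  refine stabProb_empty_pos_of_nat (x - 1).toNat η (by omega) ?_
  rwa [show 1 + ((x - 1).toNat : ℤ) = x by omega]

/-! ### Bounded harmonic functions and the addition of particles -/

/-- A function on configurations is harmonic with respect to legal topplings in `V_n`. -/
def IsHarmonic (lam p : ℝ) (n : ℕ) (F : Config → ℝ) : Prop :=
  ∀ η, ∀ z ∈ segment n, IsUnstable η z →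
    F η = ∑ i, instrWeight lam p i * F (applyInstr i z η)

theorem isHarmonic_stabProb (T : Set (StableConfig n)) :
    IsHarmonic lam p n (stabProb lam p hlam hp T) := fun _ _ hz hu => stabProb_eq_sum T hz hu

theorem IsHarmonic.le (hlam : 0 < lam) (hp : p ∈ Set.Ioo (0 : ℝ) 1) {F G : Config → ℝ} {M : ℝ}
    (hF : IsHarmonic lam p n F) (hG : IsHarmonic lam p n G)
    (hM : ∀ η, |F η| ≤ M) (hM' : ∀ η, |G η| ≤ M)
    (h : ∀ η, (∀ z ∈ segment n, ¬ IsUnstable η z) → F η ≤ G η) (η : Config) : F η ≤ G η := by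
  have hM0 : 0 ≤ M := (abs_nonneg _).trans (hM η)
  have := nonneg_of_superharmonic hlam hp (n := n) (g := fun η => G η - F η) (M := 2 * M)
    (by linarith) (fun η => by have := abs_le.1 (hM η); have := abs_le.1 (hM' η); linarith)
    (fun η hη => by
      by_contra! hcon
      have hun : ∃ z ∈ segment n, IsUnstable η z := by
        by_contra! hst
        linarith [h η hst]
      obtain ⟨z, hz, hu⟩ := hun
      have h1 := hcon z hz hu
      simp only [mul_sub, Finset.sum_sub_distrib] at h1
      rw [← hF η z hz hu, ← hG η z hz hu] at h1
      exact lt_irrefl _ h1) η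
  linarith

theorem toConfig_stableOf {η : Config} (hη : ∀ y ∈ segment n, ¬ IsUnstable η y) :
    ∀ y ∈ segment n, η y = (stableOf n η).toConfig y := by
  intro y hy
  rw [StableConfig.toConfig, dif_pos hy]
  exact (eq_value_iff_of_stable hη _).2 rfl ⟨y, hy⟩

/-- A bounded harmonic function is determined by its values on stable configurations. -/
theorem IsHarmonic.eq_sum {F : Config → ℝ} {M : ℝ} (hF : IsHarmonic lam p n F)
    (hM : ∀ η, |F η| ≤ M)
    (hloc : ∀ η ζ : Config, (∀ y ∈ segment n, η y = ζ y) → F η = F ζ) (η : Config) :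
    F η = ∑ C : StableConfig n, stabProb lam p hlam hp {C} η * F C.toConfig := by
  set G : Config → ℝ :=
    fun η => ∑ C : StableConfig n, stabProb lam p hlam hp {C} η * F C.toConfig with hGdef
  have hM0 : 0 ≤ M := (abs_nonneg _).trans (hM η)
  have hG : IsHarmonic lam p n G := by
    intro η z hz hu
    simp only [hGdef, Finset.mul_sum]
    rw [Finset.sum_comm]
    refine Finset.sum_congr rfl fun C _ => ?_
    rw [stabProb_eq_sum _ hz hu, Finset.sum_mul]
    exact Finset.sum_congr rfl fun i _ => by ring
  have hGM : ∀ η, |G η| ≤ ∑ _C : StableConfig n, M := by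
    intro η
    refine (Finset.abs_sum_le_sum_abs _ _).trans (Finset.sum_le_sum fun C _ => ?_)
    rw [abs_mul, abs_of_nonneg (stabProb_nonneg _ _)]
    exact (mul_le_of_le_one_left (abs_nonneg _) (stabProb_le_one _ _)).trans (hM _)
  have hFM : ∀ η, |F η| ≤ ∑ _C : StableConfig n, M := by
    intro η
    refine (hM η).trans ?_
    rw [Finset.sum_const, nsmul_eq_mul]
    refine le_mul_of_one_le_left hM0 ?_
    exact_mod_cast Finset.card_pos.2 (Finset.univ_nonempty (α := StableConfig n))
  have hst : ∀ η, (∀ z ∈ segment n, ¬ IsUnstable η z) → F η = G η := by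
    intro η hη
    simp only [hGdef, stabProb_of_stable _ hη]
    rw [Finset.sum_eq_single (stableOf n η)]
    -- Particles outside `V_n` may remain in `η`, so the locality of `F` is needed to replace `η` by
    -- `toConfig`.
    · simpa using hloc _ _ (toConfig_stableOf hη)
    · intro C _ hC
      simp [hC.symm]
    · simp
  exact le_antisymm (hF.le hlam hp hG hFM hGM (fun η hη => (hst η hη).le) η)
    (hG.le hlam hp hF hGM hFM (fun η hη => (hst η hη).ge) η)

theorem abs_stabProb_le_one (T : Set (StableConfig n)) (η : Config) :
    |stabProb lam p hlam hp T η| ≤ 1 := by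
  rw [abs_of_nonneg (stabProb_nonneg _ _)]
  exact stabProb_le_one _ _

theorem StableConfig.not_isUnstable_toConfig (C : StableConfig n) :
    ∀ y ∈ segment n, ¬ IsUnstable C.toConfig y := by
  intro y hy
  refine StableConfig.not_isUnstable_of_eq (B := C) (y := ⟨y, hy⟩) ?_
  rw [StableConfig.toConfig, dif_pos hy]

theorem stableOf_toConfig (C : StableConfig n) : stableOf n C.toConfig = C := by
  refine ((eq_value_iff_of_stable C.not_isUnstable_toConfig C).1 fun y => ?_).symm
  rw [StableConfig.toConfig, dif_pos y.2]

theorem stabProb_eq_sum_indicator (T : Set (StableConfig n)) (η : Config) :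
    stabProb lam p hlam hp T η =
      ∑ C : StableConfig n, stabProb lam p hlam hp {C} η * T.indicator 1 C := by
  rw [(isHarmonic_stabProb T).eq_sum (hlam := hlam) (hp := hp) (abs_stabProb_le_one T)
    (fun _ _ h => stabProb_congr T h) η]
  refine Finset.sum_congr rfl fun C _ => ?_
  rw [stabProb_of_stable T C.not_isUnstable_toConfig, stableOf_toConfig]

/-- Almost surely, the stabilization in `V_n` terminates. -/
theorem sum_stabProb_singleton (η : Config) :
    ∑ C : StableConfig n, stabProb lam p hlam hp {C} η = 1 := by
  have hF : IsHarmonic lam p n fun _ => 1 := by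
    intro η z _ _
    simp [sum_instrWeight_real p hlam]
  simpa using (hF.eq_sum (hlam := hlam) (hp := hp) (M := 1) (by simp) (fun _ _ _ => rfl) η).symm

theorem stabProb_univ (η : Config) :
    stabProb lam p hlam hp (Set.univ : Set (StableConfig n)) η = 1 := by
  rw [stabProb_eq_sum_indicator]
  simpa using sum_stabProb_singleton η

/-- A particle may be added after the stabilization of the other particles. -/
theorem stabProb_addParticle (T : Set (StableConfig n)) (η : Config) (x : ℤ) :
    stabProb lam p hlam hp T (addParticle η x) =
      ∑ C : StableConfig n, stabProb lam p hlam hp {C} η *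
        stabProb lam p hlam hp T (addParticle C.toConfig x) := by
  have hF : IsHarmonic lam p n fun η => stabProb lam p hlam hp T (addParticle η x) := by
    intro η z hz hu
    simp only [← applyInstr_addParticle hu]
    exact stabProb_eq_sum T hz (isUnstable_addParticle (Or.inr hu))
  refine hF.eq_sum (M := 1) (fun η => abs_stabProb_le_one T _) (fun η ζ h => ?_) η
  refine stabProb_congr T fun y hy => ?_
  simp only [addParticle_apply, h y hy]

/-! ### The number of remaining particles -/

/-- The number of particles of `η` in `V_n`. -/
noncomputable def particleCount (n : ℕ) (η : Config) : ℕ := ∑ y ∈ segment n, (η y).count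

theorem card_stableOf {η : Config} (hη : ∀ y ∈ segment n, ¬ IsUnstable η y) :
    (stableOf n η).card = particleCount n η := by
  classical
  rw [particleCount, ← Finset.sum_coe_sort, stableOf, Finset.card_filter]
  refine Finset.sum_congr rfl fun y _ => ?_
  have h := hη y y.2
  rcases hs : η y with (_ | k) | _
  · simp [IsOccupied, hs, SiteState.count]
  · exact absurd ⟨k, hs⟩ h
  · simp [IsOccupied, hs, SiteState.count]

theorem particleCount_applyInstr {η : Config} {z : ℤ} (hz : z ∈ segment n)
    (hu : IsUnstable η z) (i : Instruction) :
    (particleCount n (applyInstr i z η) : ℝ) =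
      particleCount n η + (if i.target z ∈ segment n then 1 else 0) - 1 := by
  simp only [particleCount, Nat.cast_sum, count_applyInstr hu, Finset.sum_sub_distrib,
    Finset.sum_add_distrib, Finset.sum_ite_eq', if_pos hz]

theorem particleCount_applyInstr_le {η : Config} {z : ℤ} (hz : z ∈ segment n)
    (hu : IsUnstable η z) (i : Instruction) :
    particleCount n (applyInstr i z η) ≤ particleCount n η := by
  have := particleCount_applyInstr hz hu i
  rw [← Nat.cast_le (α := ℝ), this]
  split_ifs <;> linarith

/-- The stable configurations with at least `k` particles. -/
def atLeast (n k : ℕ) : Set (StableConfig n) := {B | k ≤ B.card}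

theorem stabProb_atLeast_of_stable {k : ℕ} {η : Config}
    (hη : ∀ y ∈ segment n, ¬ IsUnstable η y) :
    stabProb lam p hlam hp (atLeast n k) η = if k ≤ particleCount n η then 1 else 0 := by
  rw [stabProb_of_stable _ hη, ← card_stableOf hη]
  by_cases h : k ≤ (stableOf n η).card <;> simp [atLeast, h]

/-- Topplings in `V_n` never create particles, so the set of configurations with fewer than `k`
particles is closed under them, and the minimum principle applies to minus the probability
restricted to it. -/
theorem stabProb_atLeast_eq_zero {k : ℕ} {η : Config} (h : particleCount n η < k) :
    stabProb lam p hlam hp (atLeast n k) η = 0 := by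
  have key := nonneg_of_superharmonic hlam hp (n := n)
    (g := fun η => if particleCount n η < k then -stabProb lam p hlam hp (atLeast n k) η else 0)
    (M := 1) zero_le_one ?_ ?_ η
  · simp only [if_pos h] at key
    exact le_antisymm (by linarith) (stabProb_nonneg _ _)
  · intro η
    have := stabProb_le_one (hlam := hlam) (hp := hp) (atLeast n k) η
    split_ifs <;> linarith
  · intro η hη
    have hk : particleCount n η < k := by
      by_contra hk
      simp [hk] at hη
    simp only [if_pos hk] at hη ⊢
    have hun : ∃ z ∈ segment n, IsUnstable η z := by
      by_contra! hst
      rw [stabProb_atLeast_of_stable hst, if_neg (by omega)] at hη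
      simp at hη
    obtain ⟨z, hz, hu⟩ := hun
    refine ⟨z, hz, hu, ?_⟩
    simp only [if_pos ((particleCount_applyInstr_le hz hu _).trans_lt hk), mul_neg,
      Finset.sum_neg_distrib]
    rw [← stabProb_eq_sum _ hz hu]

/-! ### Monotonicity: waking particles and adding active ones -/

/-- The configuration obtained by waking up the particle at `y`, if it sleeps. -/
def wake (y : ℤ) (η : Config) : Config := Function.update η y (.active (η y).count)

theorem wake_apply (y : ℤ) (η : Config) (z : ℤ) :
    wake y η z = if z = y then .active (η z).count else η z := by
  rw [wake, Function.update_apply]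
  split_ifs with h
  · rw [h]
  · rfl

theorem wake_eq_self {y : ℤ} {η : Config} (h : η y ≠ .sleeping) : wake y η = η := by
  funext z
  rw [wake_apply]
  split_ifs with hz
  · subst hz
    cases hs : η z
    · rfl
    · exact absurd hs h
  · rfl

theorem applyInstr_wake {y z : ℤ} {η : Config} (hyz : z ≠ y) (i : Instruction)
    (hy : η y = .sleeping) : applyInstr i z (wake y η) = wake y (applyInstr i z η) := by
  funext v
  have hadd : SiteState.add (.active SiteState.sleeping.count) =
      .active SiteState.sleeping.add.count := rfl
  simp only [applyInstr_apply, wake_apply]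
  grind

theorem particleCount_wake (y : ℤ) (η : Config) :
    particleCount n (wake y η) = particleCount n η := by
  refine Finset.sum_congr rfl fun z _ => ?_
  rw [wake_apply]
  split_ifs <;> rfl

/-- Waking up a particle makes the number of remaining particles smaller. -/
theorem stabProb_atLeast_wake_le (k : ℕ) (y : ℤ) (η : Config) :
    stabProb lam p hlam hp (atLeast n k) (wake y η) ≤ stabProb lam p hlam hp (atLeast n k) η := by
  have key := nonneg_of_superharmonic hlam hp (n := n)
    (g := fun η => stabProb lam p hlam hp (atLeast n k) η -
      stabProb lam p hlam hp (atLeast n k) (wake y η)) (M := 1) zero_le_one ?_ ?_ η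
  · linarith
  · intro η
    have := stabProb_le_one (hlam := hlam) (hp := hp) (atLeast n k) (wake y η)
    have := stabProb_nonneg (hlam := hlam) (hp := hp) (atLeast n k) η
    linarith
  · intro η hη
    have hy : η y = .sleeping := by
      by_contra hy
      rw [wake_eq_self hy, sub_self] at hη
      exact lt_irrefl _ hη
    have hun : ∃ z ∈ segment n, IsUnstable η z := by
      by_contra! hst
      rw [stabProb_atLeast_of_stable hst] at hη
      by_cases hk : k ≤ particleCount n η
      · rw [if_pos hk] at hη
        linarith [stabProb_le_one (hlam := hlam) (hp := hp) (atLeast n k) (wake y η)]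
      · rw [if_neg hk, stabProb_atLeast_eq_zero (by rw [particleCount_wake]; omega)] at hη
        simp at hη
    obtain ⟨z, hz, hu⟩ := hun
    -- As `y` hosts a sleeper, the same site `z ≠ y` can be toppled in both configurations, and this
    -- commutes with waking `y`. If a particle reaches `y`, the two configurations merge and the
    -- difference vanishes.
    have hzy : z ≠ y := by
      rintro rfl
      obtain ⟨m, hm⟩ := hu
      rw [hy] at hm
      cases hm
    have hu' : IsUnstable (wake y η) z := by
      rwa [IsUnstable, wake_apply, if_neg hzy]
    refine ⟨z, hz, hu, le_of_eq ?_⟩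
    rw [stabProb_eq_sum _ hz hu, stabProb_eq_sum _ hz hu']
    simp only [applyInstr_wake hzy _ hy, mul_sub, Finset.sum_sub_distrib]

/-- The configuration with `c z` active particles at each site `z`. -/
def activeConfig (c : ℤ → ℕ) : Config := fun z => .active (c z)

theorem stabProb_atLeast_activeConfig_count_le (k : ℕ) (η : Config) :
    stabProb lam p hlam hp (atLeast n k) (activeConfig fun z => (η z).count) ≤
      stabProb lam p hlam hp (atLeast n k) η := by
  classical
  have key : ∀ S : Finset ℤ, stabProb lam p hlam hp (atLeast n k)
      (fun z => if z ∈ S then .active (η z).count else η z) ≤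
        stabProb lam p hlam hp (atLeast n k) η := by
    intro S
    induction S using Finset.induction_on with
    | empty => simp
    | insert y S _ ih =>
      refine le_trans (le_of_eq ?_) ((stabProb_atLeast_wake_le k y _).trans ih)
      congr 1
      funext z
      rw [wake_apply]
      by_cases h1 : z = y <;> by_cases h2 : z ∈ S <;> simp [h1, h2]
      · subst h1
        simp [h2, SiteState.count]
      · subst h1
        simp [h2]
  refine le_trans (le_of_eq (stabProb_congr _ fun y hy => ?_)) (key (segment n))
  rw [if_pos hy]
  rfl

theorem applyInstr_activeConfig_left (c : ℤ → ℕ) (y : ℤ) :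
    applyInstr .left y (activeConfig (c + Pi.single y 1)) =
      activeConfig (c + Pi.single (y - 1) 1) := by
  funext z
  rw [applyInstr_apply]
  by_cases h1 : z = y
  · subst h1
    simp [activeConfig, Instruction.own, SiteState.remove]
  · by_cases h2 : z = y - 1 <;>
      simp [activeConfig, Instruction.target, h1, h2, SiteState.add]

theorem applyInstr_activeConfig_right (c : ℤ → ℕ) (y : ℤ) :
    applyInstr .right y (activeConfig (c + Pi.single y 1)) =
      activeConfig (c + Pi.single (y + 1) 1) := by
  funext z
  rw [applyInstr_apply]
  by_cases h1 : z = y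
  · subst h1
    simp [activeConfig, Instruction.own, SiteState.remove]
  · by_cases h2 : z = y + 1 <;>
      simp [activeConfig, Instruction.target, h1, h2, SiteState.add]

theorem wake_applyInstr_activeConfig_sleep (c : ℤ → ℕ) (y : ℤ) :
    wake y (applyInstr .sleep y (activeConfig (c + Pi.single y 1))) =
      activeConfig (c + Pi.single y 1) := by
  funext z
  rw [wake_apply, applyInstr_apply]
  by_cases h1 : z = y
  · subst h1
    rcases h : c z with _ | k <;>
      simp [activeConfig, Instruction.own, h, SiteState.sleep, SiteState.count]
  · simp [h1, Instruction.target]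

/-- Adding an active particle to a configuration without sleeping particles makes the number of
remaining particles larger. -/
theorem stabProb_atLeast_le_add_single (k : ℕ) (c : ℤ → ℕ) (y : ℤ) :
    stabProb lam p hlam hp (atLeast n k) (activeConfig c) ≤
      stabProb lam p hlam hp (atLeast n k) (activeConfig (c + Pi.single y 1)) := by
  set D : ℤ → ℝ := fun y => stabProb lam p hlam hp (atLeast n k)
    (activeConfig (c + Pi.single y 1)) - stabProb lam p hlam hp (atLeast n k) (activeConfig c)
    with hD
  have hout : ∀ y ∉ segment n, D y = 0 := by
    intro y hy
    rw [hD]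
    refine sub_eq_zero.2 (stabProb_congr _ fun z hz => ?_)
    have : z ≠ y := fun h => hy (h ▸ hz)
    simp [activeConfig, this]
  -- After a sleep instruction, waking `y` restores the configuration, so that branch is worth at
  -- least the original value. Solving for it eliminates `lam` and makes `D` superharmonic for the
  -- walk alone.
  have hsup : ∀ y ∈ segment n, p * D (y - 1) + (1 - p) * D (y + 1) ≤ D y := by
    intro y hy
    have hu : IsUnstable (activeConfig (c + Pi.single y 1)) y := ⟨c y, by simp [activeConfig]⟩
    have h1 := stabProb_eq_sum (hlam := hlam) (hp := hp) (atLeast n k) hy hu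
    rw [sum_instruction, applyInstr_activeConfig_left, applyInstr_activeConfig_right] at h1
    have h2 := stabProb_atLeast_wake_le (hlam := hlam) (hp := hp) (n := n) k y
      (applyInstr .sleep y (activeConfig (c + Pi.single y 1)))
    rw [wake_applyInstr_activeConfig_sleep] at h2
    simp only [instrWeight] at h1
    have hl1 : 0 < 1 + lam := by linarith
    field_simp at h1
    simp only [hD]
    nlinarith
  suffices h : 0 ≤ D y by
    simp only [hD] at h
    linarith
  by_contra! hneg
  have hy : y ∈ segment n := by
    by_contra hy
    rw [hout y hy] at hneg
    exact lt_irrefl _ hneg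
  -- The lexicographic order selects the leftmost minimizer, so the inequality with its left
  -- neighbour is strict, which contradicts superharmonicity. Outside `V_n` the value `0` already
  -- exceeds the negative minimum.
  obtain ⟨m, hm, hmin⟩ := Finset.exists_min_image (segment n)
    (fun y => toLex (D y, y)) ⟨y, hy⟩
  have hmin' : ∀ z ∈ segment n, D m < D z ∨ D m = D z ∧ m ≤ z := fun z hz => by
    simpa [Prod.Lex.le_iff] using hmin z hz
  have hm0 : D m < 0 := by
    rcases hmin' y hy with h | h <;> linarith [h]
  have h1 : D m < D (m - 1) := by
    by_cases h : m - 1 ∈ segment n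
    · rcases hmin' _ h with h | h
      · exact h
      · omega
    · rwa [hout _ h]
  have h2 : D m ≤ D (m + 1) := by
    by_cases h : m + 1 ∈ segment n
    · rcases hmin' _ h with h | h
      · exact h.le
      · exact h.1.le
    · rw [hout _ h]
      exact hm0.le
  have h3 := hsup m hm
  have h4 : p * D m < p * D (m - 1) := mul_lt_mul_of_pos_left h1 hp.1
  have h5 : (1 - p) * D m ≤ (1 - p) * D (m + 1) :=
    mul_le_mul_of_nonneg_left h2 (by linarith [hp.2])
  linarith

theorem stabProb_atLeast_le_add_sum (k : ℕ) (c : ℤ → ℕ) (S : Finset ℤ) :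
    stabProb lam p hlam hp (atLeast n k) (activeConfig c) ≤
      stabProb lam p hlam hp (atLeast n k)
        (activeConfig (c + fun z => if z ∈ S then 1 else 0)) := by
  classical
  induction S using Finset.induction_on with
  | empty => exact le_of_eq (by congr)
  | insert y S hy ih =>
    refine ih.trans ((stabProb_atLeast_le_add_single k _ y).trans (le_of_eq ?_))
    congr 2
    funext z
    by_cases h : z = y
    · subst h
      simp [hy]
    · simp [h]

theorem count_iterate_addParticle (η : Config) (x : ℤ) (k : ℕ) :
    (fun z => ((((fun ζ => addParticle ζ x)^[k]) η) z).count) =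
      (Pi.single x k : ℤ → ℕ) + fun z => (η z).count := by
  induction k with
  | zero => simp
  | succ k ih =>
    funext z
    have h := congrFun ih z
    rw [Function.iterate_succ_apply', addParticle_apply]
    by_cases hz : z = x
    · subst hz
      have hadd : ∀ s : SiteState, s.add.count = s.count + 1 := by rintro (_ | _) <;> rfl
      simp only [if_true, hadd, h, Pi.add_apply, Pi.single_eq_same]
      omega
    · simpa [hz] using h

/-- All sleepers of `A` are woken, then removed: both operations lower the probability of keeping at
least `k` particles. -/
theorem stabProb_atLeast_single_le (k : ℕ) (x : ℤ) (A : StableConfig n) :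
    stabProb lam p hlam hp (atLeast n k) (activeConfig (Pi.single x k)) ≤
      stabProb lam p hlam hp (atLeast n k) ((fun ζ => addParticle ζ x)^[k] A.toConfig) := by
  refine le_trans ?_ (stabProb_atLeast_activeConfig_count_le k _)
  rw [count_iterate_addParticle]
  refine (stabProb_atLeast_le_add_sum k _ (A.map (Function.Embedding.subtype _))).trans
    (le_of_eq ?_)
  congr 3
  funext z
  rw [StableConfig.toConfig]
  by_cases hz : z ∈ segment n
  · rw [dif_pos hz, StableConfig.value]
    by_cases h : (⟨z, hz⟩ : segment n) ∈ A
    · rw [if_pos h, if_pos]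
      · rfl
      · exact Finset.mem_map.2 ⟨⟨z, hz⟩, h, rfl⟩
    · rw [if_neg h, if_neg]
      · rfl
      · rintro h'
        obtain ⟨w, hw, rfl⟩ := Finset.mem_map.1 h'
        exact h hw
  · rw [dif_neg hz, if_neg]
    · rfl
    · rintro h'
      obtain ⟨w, hw, rfl⟩ := Finset.mem_map.1 h'
      exact hz w.2

end

/-! ### Translation invariance and conservation of the number of particles -/

/-- The state obtained from `s` by a translation by `x`. -/
def State.translate (x : ℤ) (s : State) : State :=
  ⟨fun z => s.config (z - x), fun z => s.odometer (z - x)⟩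

/-- The array of instructions seen from `x`. -/
def viewFrom (x : ℤ) (τ : InstrArray) : InstrArray := fun a => τ (a.1 + x, a.2)

theorem topple_translate (τ : InstrArray) (x y : ℤ) (s : State) :
    topple τ (s.translate x) (y + x) = (topple (viewFrom x τ) s y).translate x := by
  have hsub : ∀ z : ℤ, z - x = y ↔ z = y + x := fun z => sub_eq_iff_eq_add
  have htar : ∀ (i : Instruction) (z : ℤ), z = i.target (y + x) ↔ z - x = i.target y := by
    intro i z
    cases i <;> simp only [Instruction.target] <;> omega
  simp only [topple, State.translate, State.mk.injEq, viewFrom, add_sub_cancel_right]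
  constructor
  · funext z
    simp only [applyInstr_apply, add_sub_cancel_right, hsub, htar]
  · funext z
    simp only [Function.update_apply, hsub]

theorem isLegal_translate (τ : InstrArray) (x : ℤ) (α : List ℤ) : ∀ s : State,
    IsLegal τ (s.translate x) (α.map (· + x)) ↔ IsLegal (viewFrom x τ) s α := by
  induction α with
  | nil => intro s; exact Iff.rfl
  | cons y α ih =>
    intro s
    simp only [List.map_cons, IsLegal, topple_translate, ih]
    simp only [IsUnstable, State.translate, add_sub_cancel_right]

theorem run_translate (τ : InstrArray) (x : ℤ) (α : List ℤ) : ∀ s : State,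
    run τ (s.translate x) (α.map (· + x)) = (run (viewFrom x τ) s α).translate x := by
  induction α with
  | nil => intro s; rfl
  | cons y α ih =>
    intro s
    simpa only [run, List.map_cons, List.foldl_cons, topple_translate] using ih _

theorem translate_init_pointSource (x : ℤ) (k : ℕ) :
    (State.init (pointSource k)).translate x = State.init (activeConfig (Pi.single x k)) := by
  simp only [State.translate, State.init, State.mk.injEq, and_true]
  funext z
  by_cases h : z = x
  · subst h
    simp [pointSource, activeConfig]
  · simp [pointSource, activeConfig, h, sub_eq_zero]

/-- The law of the array of instructions is invariant under translations. -/
theorem arrayLaw_preimage_viewFrom {lam p : ℝ} (hlam : 0 < lam) (hp : p ∈ Set.Ioo (0 : ℝ) 1)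
    (x : ℤ) (W : Set InstrArray) :
    arrayLaw lam p hlam hp (viewFrom x ⁻¹' W) = arrayLaw lam p hlam hp W := by
  let e : ℤ × ℕ ≃ ℤ × ℕ := (Equiv.subRight x).prodCongr (Equiv.refl ℕ)
  have h := Measure.infinitePi_map_piCongrLeft
    (fun _ : ℤ × ℕ => (instrLaw lam p hlam hp).toMeasure) e
  have hv : (MeasurableEquiv.piCongrLeft (fun _ : ℤ × ℕ => Instruction) e : InstrArray → _) =
      viewFrom x := by
    funext τ a
    obtain ⟨b, rfl⟩ := e.surjective a
    rw [MeasurableEquiv.coe_piCongrLeft, Equiv.piCongrLeft_apply_apply]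
    simp [viewFrom, e]
  -- Using a measurable equivalence makes the identity valid for every set `W`, so the measurability
  -- of the confinement event is not required.
  conv_rhs => rw [arrayLaw, ← h, MeasurableEquiv.map_apply, hv]
  rfl

/-- If no legal sequence sends a particle out of `V_n`, then the number of particles in `V_n` is
conserved. -/
theorem particleCount_run_eq {n : ℕ} {τ : InstrArray} {α : List ℤ} :
    ∀ {s : State}, (∀ β, IsLegal τ s β → ∀ y, IsOccupied (run τ s β).config y → y ∈ segment n) →
      IsLegal τ s α → (∀ y ∈ α, y ∈ segment n) →
      particleCount n (run τ s α).config = particleCount n s.config := by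
  induction α with
  | nil => intro s _ _ _; rfl
  | cons x α ih =>
    intro s hconf hα hV
    have hx : x ∈ segment n := hV x (by simp)
    have h1 : particleCount n (run τ (topple τ s x) α).config =
        particleCount n (topple τ s x).config :=
      ih (fun β hβ => hconf (x :: β) ⟨hα.1, hβ⟩) hα.2 fun y hy => hV y (by simp [hy])
    refine h1.trans ?_
    set i := τ (x, s.odometer x) with hi
    -- The arrival site is occupied after this single legal toppling, hence confined to `V_n` by
    -- hypothesis.
    have htar : i.target x ∈ segment n := by
      by_cases h : i.target x = x
      · rwa [h]
      · refine hconf [x] ⟨hα.1, trivial⟩ _ ?_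
        change applyInstr i x s.config (i.target x) ≠ .active 0
        rw [applyInstr_apply, if_neg h, if_pos rfl]
        obtain ⟨k, hk⟩ := (s.config (i.target x)).add_eq_active
        simp [hk]
    have h2 := particleCount_applyInstr hx hα.1 i
    rw [if_pos htar, add_sub_cancel_right] at h2
    exact_mod_cast h2

/-- Seen from `x`, the event says that the evolution from `k` particles at `x` stays in `V_n`.
Outside the null event of no stabilization, conservation of particles leaves exactly `k` of them. -/
theorem arrayLaw_aggregate_le {lam p : ℝ} (hlam : 0 < lam) (hp : p ∈ Set.Ioo (0 : ℝ) 1)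
    {n : ℕ} (k : ℕ) {x : ℤ} (hx : x ∈ segment n) :
    arrayLaw lam p hlam hp {τ | (fun y => x + y) '' aggregate k τ ⊆ (segment n : Set ℤ)} ≤
      ENNReal.ofReal (stabProb lam p hlam hp (atLeast n k) (activeConfig (Pi.single x k))) := by
  set η := activeConfig (Pi.single x k) with hη
  rw [← arrayLaw_preimage_viewFrom hlam hp x]
  have hcount : particleCount n η = k := by
    simp only [particleCount, hη, activeConfig, SiteState.count, Pi.single_apply,
      Finset.sum_ite_eq', if_pos hx]
  have hsub : viewFrom x ⁻¹' {τ | (fun y => x + y) '' aggregate k τ ⊆ (segment n : Set ℤ)} ⊆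
      {τ | ∃ B ∈ atLeast n k, StabilizesTo τ η B} ∪
        {τ | ∃ B ∈ (Set.univ : Set (StableConfig n)), StabilizesTo τ η B}ᶜ := by
    intro τ hτ
    by_cases hst : ∃ B ∈ (Set.univ : Set (StableConfig n)), StabilizesTo τ η B
    · left
      obtain ⟨B, -, α, hα, hleg, hrun⟩ := hst
      refine ⟨B, ?_, α, hα, hleg, hrun⟩
      have hconf : ∀ β, IsLegal τ (State.init η) β →
          ∀ y, IsOccupied (run τ (State.init η) β).config y → y ∈ segment n := by
        intro β hβ y hy
        obtain ⟨γ, rfl⟩ : ∃ γ : List ℤ, β = γ.map (· + x) :=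
          ⟨β.map (· - x), by simp [Function.comp_def]⟩
        rw [hη, ← translate_init_pointSource, isLegal_translate] at hβ
        rw [hη, ← translate_init_pointSource, run_translate] at hy
        have := hτ (Set.mem_image_of_mem _ ⟨γ, hβ, hy⟩)
        simpa using this
      have hstable : ∀ y ∈ segment n, ¬ IsUnstable (run τ (State.init η) α).config y :=
        fun y hy => StableConfig.not_isUnstable_of_eq (hrun ⟨y, hy⟩)
      have hB := (eq_value_iff_of_stable hstable B).1 hrun
      change k ≤ B.card
      rw [hB, card_stableOf hstable, particleCount_run_eq hconf hleg hα]
      exact hcount.ge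
    · right
      exact hst
  refine (measure_mono hsub).trans ((measure_union_le _ _).trans (le_of_eq ?_))
  have hnull : arrayLaw lam p hlam hp
      {τ | ∃ B ∈ (Set.univ : Set (StableConfig n)), StabilizesTo τ η B}ᶜ = 0 := by
    rw [prob_compl_eq_zero_iff (measurableSet_stabilizesTo η _)]
    have := stabProb_univ (hlam := hlam) (hp := hp) (n := n) η
    rwa [stabProb, measureReal_def, ENNReal.toReal_eq_one_iff] at this
  rw [hnull, add_zero, stabProb, ofReal_measureReal]

/-! ### Finite Markov chains -/

theorem sum_coe_pmf {α : Type*} [Fintype α] (π : PMF α) : ∑ a, π a = 1 :=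
  (tsum_fintype _).symm.trans π.tsum_coe

/-- A Markov chain on a finite set, with a state that can be reached in one step from every state,
has a unique stationary distribution. -/
theorem existsUnique_stationary {α : Type*} [Fintype α] (P : α → α → ENNReal)
    (hP : ∀ a, ∑ b, P a b = 1) (b₀ : α) (hb₀ : ∀ a, 0 < P a b₀) :
    ∃! π : PMF α, ∀ b, ∑ a, π a * P a b = π b := by
  classical
  obtain ⟨a₀, -, ha₀⟩ := Finset.exists_min_image Finset.univ (fun a => P a b₀) ⟨b₀, by simp⟩
  set ε := P a₀ b₀ with hε
  have hε0 : ε ≠ 0 := (hb₀ a₀).ne'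
  have hε1 : ε ≤ 1 := by
    rw [← hP a₀]
    exact Finset.single_le_sum (f := fun b => P a₀ b) (fun _ _ => zero_le) (Finset.mem_univ b₀)
  have hεtop : ε ≠ ⊤ := ne_top_of_le_ne_top ENNReal.one_ne_top hε1
  let r : α → ENNReal := fun b => if b = b₀ then ε else 0
  let Q : α → α → ENNReal := fun a b => P a b - r b
  have hPQ : ∀ a b, P a b = Q a b + r b := by
    intro a b
    refine (tsub_add_cancel_of_le ?_).symm
    by_cases hb : b = b₀
    · simpa [r, hb] using ha₀ a (Finset.mem_univ a)
    · simp [r, hb]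
  have hr : ∑ b, r b = ε := by simp [r]
  have hQ : ∀ a, ∑ b, Q a b = 1 - ε := by
    intro a
    refine ENNReal.eq_sub_of_add_eq hεtop ?_
    rw [← hP a, ← hr, ← Finset.sum_add_distrib]
    exact Finset.sum_congr rfl fun b _ => (hPQ a b).symm
  -- `v j` is `r Q ^ j`, of mass `ε (1 - ε) ^ j`. The series `S` has mass one and solves `S = r + S
  -- Q`, which is stationarity for probability vectors.
  let v : ℕ → α → ENNReal := fun j =>
    Nat.rec r (fun _ w b => ∑ a, w a * Q a b) j
  have hv0 : v 0 = r := rfl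
  have hvs : ∀ j b, v (j + 1) b = ∑ a, v j a * Q a b := fun _ _ => rfl
  have hvsum : ∀ j, ∑ b, v j b = ε * (1 - ε) ^ j := by
    intro j
    induction j with
    | zero => simpa [hv0] using hr
    | succ j ih =>
      simp only [hvs]
      rw [Finset.sum_comm]
      simp only [← Finset.mul_sum, hQ]
      rw [← Finset.sum_mul, ih, pow_succ, mul_assoc]
  let S : α → ENNReal := fun b => ∑' j, v j b
  have hS1 : ∑ b, S b = 1 := by
    simp only [S]
    rw [← Summable.tsum_finsetSum fun _ _ => ENNReal.summable]
    simp only [hvsum]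
    rw [ENNReal.tsum_mul_left, ENNReal.tsum_geometric,
      ENNReal.sub_sub_cancel ENNReal.one_ne_top hε1, ENNReal.mul_inv_cancel hε0 hεtop]
  have hSQ : ∀ b, S b = r b + ∑ a, S a * Q a b := by
    intro b
    simp only [S]
    rw [tsum_eq_zero_add' ENNReal.summable, hv0]
    simp only [hvs, ← ENNReal.tsum_mul_right]
    rw [Summable.tsum_finsetSum fun _ _ => ENNReal.summable]
  have hstep : ∀ w : α → ENNReal, ∑ a, w a = 1 → ∀ b,
      ∑ a, w a * P a b = r b + ∑ a, w a * Q a b := by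
    intro w hw b
    simp only [hPQ, mul_add, Finset.sum_add_distrib]
    rw [← Finset.sum_mul, hw, one_mul, add_comm]
  refine ⟨PMF.ofFintype S hS1, fun b => ?_, fun π hπ => ?_⟩
  · simp only [PMF.ofFintype_apply]
    rw [hstep S hS1, ← hSQ]
  · have hπ1 := sum_coe_pmf π
    -- Iterating `π = r + π Q` shows that `π` dominates the partial sums of `S`; since both have
    -- mass one, they agree.
    have hle : ∀ (m : ℕ) (b : α), ∑ j ∈ Finset.range m, v j b ≤ π b := by
      intro m
      induction m with
      | zero => simp
      | succ m ih =>
        intro b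
        rw [Finset.sum_range_succ', hv0, add_comm, ← hπ b, hstep π hπ1 b]
        simp only [hvs]
        rw [Finset.sum_comm]
        gcongr with a
        rw [← Finset.sum_mul]
        gcongr
        exact ih a
    have hSπ : ∀ b, S b ≤ π b := fun b => ENNReal.tsum_le_of_sum_range_le fun m => hle m b
    have hStop : ∀ b, S b ≠ ⊤ := fun b => ne_top_of_le_ne_top (π.apply_ne_top b) (hSπ b)
    have hreal : ∑ b, (S b).toReal = ∑ b, (π b).toReal := by
      rw [← ENNReal.toReal_sum fun b _ => hStop b, ← ENNReal.toReal_sum fun b _ =>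
        π.apply_ne_top b, hS1, hπ1]
    have heq := (Finset.sum_eq_sum_iff_of_le fun b _ =>
      ENNReal.toReal_mono (π.apply_ne_top b) (hSπ b)).1 hreal
    ext b
    rw [PMF.ofFintype_apply]
    exact ((ENNReal.toReal_eq_toReal_iff' (hStop b) (π.apply_ne_top b)).1
      (heq b (Finset.mem_univ b))).symm

/-! ### The driven-dissipative chain -/

section

variable (lam p : ℝ) (hlam : 0 < lam) (hp : p ∈ Set.Ioo (0 : ℝ) 1) {n : ℕ}

/-- The law of the stabilization of `η` in `V_n`. -/
noncomputable def stabLaw (η : Config) (B : StableConfig n) : ENNReal :=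
  ENNReal.ofReal (stabProb lam p hlam hp {B} η)

theorem arrayLaw_stabilizesTo (η : Config) (B : StableConfig n) :
    arrayLaw lam p hlam hp {τ | StabilizesTo τ η B} = stabLaw lam p hlam hp η B := by
  simp [stabLaw, stabProb, ofReal_measureReal]

theorem transition_eq (A B : StableConfig n) :
    transition lam p hlam hp A B =
      (∑ x : segment n, stabLaw lam p hlam hp (addParticle A.toConfig x) B) / n := by
  simp only [transition, arrayLaw_stabilizesTo]

theorem sum_stabLaw (η : Config) : ∑ B : StableConfig n, stabLaw lam p hlam hp η B = 1 := by
  simp only [stabLaw]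
  rw [← ENNReal.ofReal_sum_of_nonneg fun _ _ => stabProb_nonneg _ _, sum_stabProb_singleton,
    ENNReal.ofReal_one]

theorem stabLaw_toConfig (A B : StableConfig n) :
    stabLaw lam p hlam hp A.toConfig B = if A = B then 1 else 0 := by
  rw [stabLaw, stabProb_of_stable _ A.not_isUnstable_toConfig, stableOf_toConfig]
  by_cases h : A = B <;> simp [h]

theorem stabLaw_addParticle (η : Config) (x : ℤ) (B : StableConfig n) :
    stabLaw lam p hlam hp (addParticle η x) B =
      ∑ C : StableConfig n, stabLaw lam p hlam hp η C *
        stabLaw lam p hlam hp (addParticle C.toConfig x) B := by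
  simp only [stabLaw, ← ENNReal.ofReal_mul (stabProb_nonneg _ _)]
  rw [stabProb_addParticle, ENNReal.ofReal_sum_of_nonneg fun _ _ =>
    mul_nonneg (stabProb_nonneg _ _) (stabProb_nonneg _ _)]

theorem addParticle_comm (η : Config) (x y : ℤ) :
    addParticle (addParticle η x) y = addParticle (addParticle η y) x := by
  funext z
  simp only [addParticle_apply]
  split_ifs <;> rfl

theorem existsUnique_isStationary (hn : 1 ≤ n) :
    ∃! π : PMF (StableConfig n), IsStationary lam p hlam hp π := by
  have hn0 : (n : ENNReal) ≠ 0 := by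
    rw [Nat.cast_ne_zero]
    omega
  refine existsUnique_stationary (transition lam p hlam hp) (fun A => ?_) ∅ fun A => ?_
  · simp only [transition_eq, div_eq_mul_inv]
    rw [← Finset.sum_mul, Finset.sum_comm]
    simp only [sum_stabLaw]
    simp [ENNReal.mul_inv_cancel hn0 (ENNReal.natCast_ne_top n)]
  · rw [transition_eq]
    refine ENNReal.div_pos (ne_of_gt ?_) (ENNReal.natCast_ne_top n)
    have h1 : (1 : ℤ) ∈ segment n := Finset.mem_Icc.2 ⟨le_rfl, by omega⟩
    refine lt_of_lt_of_le ?_ (Finset.single_le_sum (fun _ _ => zero_le)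
      (Finset.mem_univ (⟨1, h1⟩ : segment n)))
    exact ENNReal.ofReal_pos.2
      (stabProb_empty_pos h1 (isUnstable_addParticle (Or.inl rfl)))

variable {lam p hlam hp}

/-- The stationary distribution is invariant under the addition of a particle at a given site. -/
theorem IsStationary.sum_addParticle {π : PMF (StableConfig n)} (hn : 1 ≤ n)
    (hπ : IsStationary lam p hlam hp π) (x : ℤ) (B : StableConfig n) :
    ∑ A, π A * stabLaw lam p hlam hp (addParticle A.toConfig x) B = π B := by
  let ρ : StableConfig n → ENNReal := fun B =>
    ∑ A, π A * stabLaw lam p hlam hp (addParticle A.toConfig x) B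
  have hπ1 := sum_coe_pmf π
  have hρ : ∑ B, ρ B = 1 := by
    simp only [ρ]
    rw [Finset.sum_comm]
    simp only [← Finset.mul_sum, sum_stabLaw, mul_one, hπ1]
  -- Adding at `x` and then at a uniform site, or in the other order, amounts to stabilizing once
  -- with both particles present, so the two kernels commute.
  have hcomm : ∀ A B : StableConfig n,
      ∑ C, stabLaw lam p hlam hp (addParticle A.toConfig x) C * transition lam p hlam hp C B =
        ∑ C, transition lam p hlam hp A C * stabLaw lam p hlam hp (addParticle C.toConfig x) B := by
    intro A B
    have h1 : ∑ C, stabLaw lam p hlam hp (addParticle A.toConfig x) C *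
        transition lam p hlam hp C B =
        (∑ y : segment n, stabLaw lam p hlam hp (addParticle (addParticle A.toConfig x) y) B) /
          n := by
      simp only [transition_eq, stabLaw_addParticle lam p hlam hp (addParticle A.toConfig x),
        div_eq_mul_inv, ← mul_assoc, Finset.mul_sum]
      rw [← Finset.sum_mul, Finset.sum_comm]
    have h2 : ∑ C, transition lam p hlam hp A C *
        stabLaw lam p hlam hp (addParticle C.toConfig x) B =
        (∑ y : segment n, stabLaw lam p hlam hp (addParticle (addParticle A.toConfig y) x) B) /
          n := by
      simp only [transition_eq, div_eq_mul_inv, mul_right_comm _ ((n : ENNReal)⁻¹),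
        Finset.sum_mul]
      rw [Finset.sum_comm]
      refine Finset.sum_congr rfl fun y _ => ?_
      rw [stabLaw_addParticle lam p hlam hp (addParticle A.toConfig y) x, Finset.sum_mul]
    rw [h1, h2]
    simp only [addParticle_comm A.toConfig x]
  have hst : IsStationary lam p hlam hp (PMF.ofFintype ρ hρ) := by
    intro B
    simp only [PMF.ofFintype_apply, ρ, Finset.sum_mul, mul_assoc]
    rw [Finset.sum_comm]
    simp only [← Finset.mul_sum, hcomm]
    simp only [Finset.mul_sum, ← mul_assoc]
    rw [Finset.sum_comm]
    simp only [← Finset.sum_mul]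
    exact Finset.sum_congr rfl fun C _ => by rw [hπ C]
  exact congrArg (fun μ : PMF (StableConfig n) => μ B)
    ((existsUnique_isStationary lam p hlam hp hn).unique hst hπ)

/-- Stabilizing after `k` simultaneous additions has the same law as stabilizing after each one, and
each single addition preserves `π`. -/
theorem IsStationary.sum_iterate_addParticle {π : PMF (StableConfig n)} (hn : 1 ≤ n)
    (hπ : IsStationary lam p hlam hp π) (x : ℤ) (k : ℕ) (B : StableConfig n) :
    ∑ A, π A * stabLaw lam p hlam hp ((fun ζ => addParticle ζ x)^[k] A.toConfig) B = π B := by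
  induction k generalizing B with
  | zero => simp [stabLaw_toConfig]
  | succ k ih =>
    have h : ∀ A : StableConfig n,
        π A * stabLaw lam p hlam hp ((fun ζ => addParticle ζ x)^[k + 1] A.toConfig) B =
          ∑ C : StableConfig n, π A * stabLaw lam p hlam hp ((fun ζ => addParticle ζ x)^[k] A.toConfig) C *
            stabLaw lam p hlam hp (addParticle C.toConfig x) B := by
      intro A
      rw [Function.iterate_succ_apply', stabLaw_addParticle, Finset.mul_sum]
      exact Finset.sum_congr rfl fun C _ => (mul_assoc _ _ _).symm
    simp only [h]
    rw [Finset.sum_comm]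
    simp only [← Finset.sum_mul, ih]
    exact hπ.sum_addParticle hn x B

theorem sleepingCountLaw_Ici (π : PMF (StableConfig n)) (k : ℕ) :
    (sleepingCountLaw π).toMeasure (Set.Ici k) = ∑ B, π B * (atLeast n k).indicator 1 B := by
  classical
  rw [sleepingCountLaw, PMF.toMeasure_apply_eq_toOuterMeasure, PMF.toOuterMeasure_map_apply,
    PMF.toOuterMeasure_apply_fintype]
  refine Finset.sum_congr rfl fun B _ => ?_
  by_cases h : k ≤ B.card <;> simp [atLeast, h]

theorem IsStationary.ofReal_stabProb_le {π : PMF (StableConfig n)} (hn : 1 ≤ n)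
    (hπ : IsStationary lam p hlam hp π) (x : ℤ) (k : ℕ) :
    ENNReal.ofReal (stabProb lam p hlam hp (atLeast n k) (activeConfig (Pi.single x k))) ≤
      (sleepingCountLaw π).toMeasure (Set.Ici k) := by
  classical
  have hπ1 := sum_coe_pmf π
  have hlaw : ∀ η : Config, ENNReal.ofReal (stabProb lam p hlam hp (atLeast n k) η) =
      ∑ B, stabLaw lam p hlam hp η B * (atLeast n k).indicator 1 B := by
    intro η
    rw [stabProb_eq_sum_indicator, ENNReal.ofReal_sum_of_nonneg]
    · refine Finset.sum_congr rfl fun B _ => ?_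
      by_cases h : B ∈ atLeast n k <;> simp [h, stabLaw]
    · intro B _
      exact mul_nonneg (stabProb_nonneg _ _) (Set.indicator_nonneg (fun _ _ => zero_le_one) _)
  calc ENNReal.ofReal (stabProb lam p hlam hp (atLeast n k) (activeConfig (Pi.single x k)))
      = ∑ A, π A * ENNReal.ofReal
          (stabProb lam p hlam hp (atLeast n k) (activeConfig (Pi.single x k))) := by
        rw [← Finset.sum_mul, hπ1, one_mul]
    _ ≤ ∑ A, π A * ENNReal.ofReal
          (stabProb lam p hlam hp (atLeast n k) ((fun ζ => addParticle ζ x)^[k] A.toConfig)) := by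
        gcongr with A
        exact stabProb_atLeast_single_le k x A
    _ = ∑ B, π B * (atLeast n k).indicator 1 B := by
        simp only [hlaw, Finset.mul_sum, ← mul_assoc]
        rw [Finset.sum_comm]
        simp only [← Finset.sum_mul, hπ.sum_iterate_addParticle hn x k]
    _ = (sleepingCountLaw π).toMeasure (Set.Ici k) := (sleepingCountLaw_Ici π k).symm

end

end ARW

theorem lemma12 (lam p : ℝ) (hlam : 0 < lam) (hp : p ∈ Set.Ioo (0 : ℝ) 1)
    (n k : ℕ) (hn : 1 ≤ n) (hk : 1 ≤ k) :
    (∃! π : PMF (ARW.StableConfig n), ARW.IsStationary lam p hlam hp π) ∧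
    ∀ π : PMF (ARW.StableConfig n), ARW.IsStationary lam p hlam hp π →
      ∀ x ∈ ARW.segment n,
        ARW.arrayLaw lam p hlam hp
            {τ | (fun y => x + y) '' ARW.aggregate k τ ⊆ (ARW.segment n : Set ℤ)}
          ≤ (ARW.sleepingCountLaw π).toMeasure (Set.Ici k) :=
  ⟨ARW.existsUnique_isStationary lam p hlam hp hn, fun _ hπ x hx =>
    (ARW.arrayLaw_aggregate_le hlam hp k hx).trans (hπ.ofReal_stabProb_le hn x k)⟩
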